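/- **Conventions.** For a finite label set $L$, an $L$-labeled graph is $G=(V,(E_a)_{a\in L})$ with $E_a\subseteq V\times V$. $\mathrm{FO(R)}$ is first-order logic over the relations $=$ and $E_a$ $(a\in L)$, extended by atomic formulas $\mathrm{Reach}_S(x,y)$ for $S\subseteq L$, which state that there is a (possibly empty) path from $x$ to $y$ all of whose labels lie in $S$. The $\mathrm{FO(R)}$-theory of $G$ is the set of $\mathrm{FO(R)}$-sentences true in $G$; it is decidable if the set of Gödel numbers of these sentences is computable. Let $G_1,G_2$ be two graphs, where the label set of $G_i$ is the disjoint union of a set of local labels and a set $\Sigma_i^s$ of synchronizing labels, and the two sets of local labels are disjoint. Let $C\subseteq(\Sigma_1^s\cup\{\epsilon\})\times(\Sigma_2^s\cup\{\epsilon\})$, and let $E_\epsilon$ denote equality. The synchronized product of $G_1,G_2$ defined by $C$ has vertex set $V_1\times V_2$; a local label of one component acts on that component and leaves the other one unchanged; and for $c=(c_1,c_2)\in C$ there is a $c$-labeled edge from $(u_1,u_2)$ to $(v_1,v_2)$ iff $E_{c_1}u_1v_1$ in $G_1$ and $E_{c_2}u_2v_2$ in $G_2$. The synchronization is semifinite if,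 for at least one of the two components $i$, only finitely many edges of $G_i$ carry a label $c_i\ne\epsilon$ with $c\in C$. If both components have label set $\Sigma$, the product synchronized on all labels is the one in which all labels are synchronizing, there are no local labels, and $C=\{(\sigma,\sigma)\mid\sigma\in\Sigma\}$. A ground tree rewriting system over a finite ranked alphabet consists of an initial finite tree $t_0$ and finitely many labeled rules $t\xrightarrow{b}t'$ between finite trees; such a rule replaces one occurrence of $t$ as a subtree by $t'$. Its graph has as vertices the trees that can be obtained from $t_0$ by the rules, and a $b$-labeled edge from $s$ to $s'$ iff $s'$ results from $s$ by one application of a rule labeled $b$. For a finite set $B$ with a disjoint copy $\bar B=\{\bar b\mid b\in B\}$, the star graph over $B$ has a center $v$ and a leaf $w_b$ for each $b\in B$; its edges are exactly one $b$-labeled edge from $v$ to $w_b$ and one $\bar b$-labeled edge from $w_b$ to $v$, for each $b\in B$. **Theorem 3.3.** Semifinite synchronization does not preserve the decidability of the $\mathrm{FO(R)}$-theory. More precisely, there are a finite set $B$ and a ground tree rewriting system with labels in $\Sigma=B\cup\bar B$ such that, for the graph $G$ generated by the system, the star graph $H$ over $B$, and the synchronized product $P$ of $G$ and $H$ synchronized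 on all labels of $\Sigma$: 1. every vertex of $G$ has finite out-degree, and the $\mathrm{FO(R)}$-theories of $G$ and of the finite graph $H$ are both decidable; 2. the synchronization is semifinite; 3. the halting problem is computably many-one reducible to the $\mathrm{FO(R)}$-theory of $P$: there is a computable function that maps (the Gödel number of) each deterministic Turing machine $M$ to (the Gödel number of) an $\mathrm{FO(R)}$-sentence $\phi_M$ such that $M$, started on the empty tape, reaches its halting state if and only if $P\models\phi_M$; 4. the $\mathrm{FO(R)}$-theory of $P$ is undecidable. -/

import Mathlib

/-- A transition system: a directed graph on the vertex set `V` whose edges carry labels in `L`. -/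
structure LGraph (L V : Type) where
  edge : L → V → V → Prop

/-- First-order formulas with reachability predicates over `L`-labeled graphs. Variables are
natural numbers; the remaining connectives and the universal quantifier are abbreviations. -/
inductive FORFormula (L : Type) : Type
  | eq (x y : ℕ) : FORFormula L
  | edge (a : L) (x y : ℕ) : FORFormula L
  | reach (S : Finset L) (x y : ℕ) : FORFormula L
  | neg (φ : FORFormula L) : FORFormula L
  | and (φ ψ : FORFormula L) : FORFormula L
  | ex (x : ℕ) (φ : FORFormula L) : FORFormula L

namespace FORFormula

variable {L : Type}

/-- The variables that occur free in a formula. -/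
def freeVars : FORFormula L → Finset ℕ
  | eq x y => {x, y}
  | edge _ x y => {x, y}
  | reach _ x y => {x, y}
  | neg φ => φ.freeVars
  | and φ ψ => φ.freeVars ∪ ψ.freeVars
  | ex x φ => φ.freeVars.erase x

/-- A sentence is a formula without free variables. -/
def IsSentence (φ : FORFormula L) : Prop := φ.freeVars = ∅

/-- The Gödel number of a formula, relative to a numbering of the labels. -/
def code [Encodable L] : FORFormula L → ℕ
  | eq x y => Nat.pair 0 (Nat.pair x y)
  | edge a x y => Nat.pair 1 (Nat.pair (Encodable.encode a) (Nat.pair x y))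
  | reach S x y => Nat.pair 2 (Nat.pair (Encodable.encode S) (Nat.pair x y))
  | neg φ => Nat.pair 3 φ.code
  | and φ ψ => Nat.pair 4 (Nat.pair φ.code ψ.code)
  | ex x φ => Nat.pair 5 (Nat.pair x φ.code)

theorem code_injective [Encodable L] :
    Function.Injective (code : FORFormula L → ℕ) := by
  intro φ
  induction φ with
  | eq x y => intro ψ h; cases ψ <;> simp_all [code]
  | edge a x y => intro ψ h; cases ψ <;> simp_all [code]
  | reach S x y => intro ψ h; cases ψ <;> simp_all [code]
  | neg φ ih =>
    intro ψ h
    cases ψ <;> simp [code] at h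
    exact congrArg _ (ih h)
  | and φ₁ φ₂ ih₁ ih₂ =>
    intro ψ h
    cases ψ <;> simp [code] at h
    exact congrArg₂ _ (ih₁ h.1) (ih₂ h.2)
  | ex x φ ih =>
    intro ψ h
    cases ψ <;> simp [code] at h
    exact congrArg₂ _ h.1 (ih h.2)

end FORFormula

namespace LGraph

variable {L V : Type}

/-- Some path, possibly of length zero, leads from `u` to `v` and uses labels from `S` only. -/
def Reach (G : LGraph L V) (S : Finset L) : V → V → Prop :=
  Relation.ReflTransGen fun u v => ∃ a ∈ S, G.edge a u v

/-- Satisfaction of a formula in `G` under an assignment of vertices to the variables. -/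
def Sat (G : LGraph L V) : FORFormula L → (ℕ → V) → Prop
  | .eq x y, s => s x = s y
  | .edge a x y, s => G.edge a (s x) (s y)
  | .reach S x y, s => G.Reach S (s x) (s y)
  | .neg φ, s => ¬ G.Sat φ s
  | .and φ ψ, s => G.Sat φ s ∧ G.Sat ψ s
  | .ex x φ, s => ∃ v, G.Sat φ (Function.update s x v)

/-- Truth of a sentence in `G`. -/
def Models (G : LGraph L V) (φ : FORFormula L) : Prop := ∀ s : ℕ → V, G.Sat φ s

/-- The FO(R)-theory of `G`, as the set of Gödel numbers of the sentences true in `G`. -/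
def theoryFOR [Encodable L] (G : LGraph L V) : Set ℕ :=
  {n | ∃ φ : FORFormula L, φ.IsSentence ∧ φ.code = n ∧ G.Models φ}

/-- The FO(R)-theory of `G` is decidable. (The label sets used are finite, so that this does not
depend on the numbering of the labels.) -/
def HasDecidableFOR [Encodable L] (G : LGraph L V) : Prop :=
  ComputablePred fun n : ℕ => n ∈ G.theoryFOR

/-- Every vertex has only finitely many outgoing edges. -/
def FiniteOutDegree (G : LGraph L V) : Prop :=
  ∀ u, {e : L × V | G.edge e.1 u e.2}.Finite

/-- The relation which one component contributes to a synchronized transition: `none` is the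
label `ε`, under which the state of the component does not change. -/
def syncEdge {Loc S : Type} (G : LGraph (Loc ⊕ S) V) : Option S → V → V → Prop
  | none, u, v => u = v
  | some a, u, v => G.edge (Sum.inr a) u v

/-- The synchronized product of two graphs defined by a synchronization constraint `C`. The labels
of each component are split into local labels (left summand) and synchronizing labels (right
summand). The labels of the product are the local labels of both components and the elements
of `C`. -/
def syncProduct {Loc₁ Loc₂ S₁ S₂ V₁ V₂ : Type} (G : LGraph (Loc₁ ⊕ S₁) V₁)
    (H : LGraph (Loc₂ ⊕ S₂) V₂) (C : Finset (Option S₁ × Option S₂)) :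
    LGraph ((Loc₁ ⊕ Loc₂) ⊕ {c // c ∈ C}) (V₁ × V₂) where
  edge
    | .inl (.inl a), u, v => G.edge (.inl a) u.1 v.1 ∧ u.2 = v.2
    | .inl (.inr a), u, v => H.edge (.inl a) u.2 v.2 ∧ u.1 = v.1
    | .inr c, u, v => G.syncEdge c.1.1 u.1 v.1 ∧ H.syncEdge c.1.2 u.2 v.2

/-- The synchronization is semifinite: in at least one of the two components only finitely many
edges are synchronized. -/
def IsSemifinite {Loc₁ Loc₂ S₁ S₂ V₁ V₂ : Type} (G : LGraph (Loc₁ ⊕ S₁) V₁)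
    (H : LGraph (Loc₂ ⊕ S₂) V₂) (C : Finset (Option S₁ × Option S₂)) : Prop :=
  {e : V₁ × S₁ × V₁ | (∃ c ∈ C, c.1 = some e.2.1) ∧ G.edge (.inr e.2.1) e.1 e.2.2}.Finite ∨
  {e : V₂ × S₂ × V₂ | (∃ c ∈ C, c.2 = some e.2.1) ∧ H.edge (.inr e.2.1) e.1 e.2.2}.Finite

/-- `G` with all labels declared to be synchronizing. -/
def allSync (G : LGraph L V) : LGraph (Empty ⊕ L) V where
  edge a u v := match a with
    | .inr a => G.edge a u v

end LGraph

/-- The constraint which synchronizes equal labels, for all labels. -/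
def diagConstraint (L : Type) [Fintype L] [DecidableEq L] : Finset (Option L × Option L) :=
  Finset.univ.image fun a => (some a, some a)

/-- The star graph over `B`: a center `none` and a leaf `some b` for each `b`. There is an edge
labeled `b` (that is, `Sum.inl b`) from the center to the leaf of `b`, and an edge labeled by the
barred copy of `b` (that is, `Sum.inr b`) back. -/
def starGraph (B : Type) : LGraph (B ⊕ B) (Option B) where
  edge
    | .inl b, u, v => u = none ∧ v = some b
    | .inr b, u, v => u = some b ∧ v = none

/-- Finite trees over a ranked alphabet; a node labeled `a` has `ar a` ordered children. -/
abbrev RankedTree {A : Type} (ar : A → ℕ) : Type := WType fun a : A => Fin (ar a)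

/-- `Rewrite l r s s'`: replacing one occurrence of `l` as a subtree of `s` by `r` yields `s'`. -/
inductive Rewrite {A : Type} {ar : A → ℕ} (l r : RankedTree ar) :
    RankedTree ar → RankedTree ar → Prop
  | root : Rewrite l r l r
  | child (a : A) (f : Fin (ar a) → RankedTree ar) (i : Fin (ar a)) (t : RankedTree ar)
      (h : Rewrite l r (f i) t) :
      Rewrite l r (WType.mk a f) (WType.mk a (Function.update f i t))

/-- A ground tree rewriting system over a ranked alphabet, with rules labeled in `L`: a triple
`(l, b, r)` in `rules` is the rule replacing `l` by `r` with label `b`. -/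
structure GTRS {A : Type} (ar : A → ℕ) (L : Type) where
  rules : Set (RankedTree ar × L × RankedTree ar)
  finite_rules : rules.Finite
  init : RankedTree ar

namespace GTRS

variable {A L : Type} {ar : A → ℕ}

/-- `s'` results from `s` by the application of a rule labeled `b`. -/
def Step (R : GTRS ar L) (b : L) (s s' : RankedTree ar) : Prop :=
  ∃ l r, (l, b, r) ∈ R.rules ∧ Rewrite l r s s'

/-- The vertices of the generated graph: the trees that can be obtained from the initial tree. -/
abbrev Vertex (R : GTRS ar L) : Type :=
  {t : RankedTree ar // Relation.ReflTransGen (fun s s' => ∃ b, R.Step b s s') R.init t}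

/-- The graph generated by a ground tree rewriting system. -/
def graph (R : GTRS ar L) : LGraph L R.Vertex where
  edge b s s' := R.Step b s.1 s'.1

end GTRS

/-- Deterministic Turing machines with a two-way infinite tape. The states are `Fin numStates`,
the tape alphabet is `Fin (numSymbols + 1)`, and the symbol `0` is the blank. -/
structure DTM where
  numStates : ℕ
  numSymbols : ℕ
  start : Fin numStates
  halt : Fin numStates
  δ : Fin numStates → Fin (numSymbols + 1) →
    Fin numStates × Fin (numSymbols + 1) × Turing.Dir

namespace DTM

/-- A configuration consists of the state and the tape, the latter relative to the head and up to
leading and trailing blanks. -/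
abbrev Config (M : DTM) : Type := Fin M.numStates × Turing.Tape (Fin (M.numSymbols + 1))

/-- One step: write a symbol, then move the head. -/
def step (M : DTM) (c : M.Config) : M.Config :=
  let t := M.δ c.1 c.2.head
  (t.1, (c.2.write t.2.1).move t.2.2)

/-- The machine, started on the empty tape, reaches its halting state. -/
def HaltsOnEmptyTape (M : DTM) : Prop :=
  ∃ n : ℕ, (M.step^[n] (M.start, Turing.Tape.mk₁ [])).1 = M.halt

/-- A direction as a Boolean: `true` for right. -/
def dirBit : Turing.Dir → Bool
  | .left => false
  | .right => true

/-- The Gödel number of a machine: number of states and symbols, start state, halting state, and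
the table of the transition function. -/
def code (M : DTM) : ℕ :=
  Encodable.encode (M.numStates, M.numSymbols, (M.start : ℕ), (M.halt : ℕ),
    List.ofFn fun q => List.ofFn fun a =>
      (((M.δ q a).1 : ℕ), ((M.δ q a).2.1 : ℕ), dirBit (M.δ q a).2.2))

end DTM

/-! A transition `(q, op, q')` of a counter machine couples a change of state with an operation on
the counters. In the graph `G` this coupling is cut: one label of the transition changes the state,
the barred copy performs the operation, and nothing forces the two to be used together. So `G` is an
asynchronous product of a finite graph and some counters. A ground tree rewriting system generates
it, with the state and each counter on a branch of its own. The star restores the coupling: once `b`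
has led to the leaf of `b`, the barred copy of `b` is the only way back. Between vertices over the
center, reachability in `P` is therefore reachability between machine configurations
(`starProduct_reach_iff`).

The theory of `G` is decidable because reachability splits into a condition on the states and, for
each counter, a mere comparison of two values (`counterGraph_reach_iff`). All atomic relations then
depend only on states and on counter sizes and differences truncated at 2. An Ehrenfeucht-Fraïssé
argument (`NatSim.extend`, `LGraph.sat_of_stateSim`) bounds the witnesses needed for quantifiers, so
that formulas can be evaluated by recursion on their Gödel numbers
(`LGraph.hasDecidableFOR_of_bounded_witnesses`).

For undecidability one universal machine is fixed (`exists_universal_counterMachine`): a program for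
a primitive recursive function, run inside one unbounded search. Since `P` is fixed, the input has
to enter through the sentence. The sentence guesses a vertex, tests all counters for zero,
increments one counter `n` times by nested quantifiers, and asks whether the halting state is
reachable (`models_acceptSentence_iff`). Turing machines are covered because being in the halting
state after `t` steps is primitive recursive, so that halting is an instance of the halting problem
for partial recursive functions. -/

open Function

/-! ### Evaluation of FO(R)-formulas on Gödel numbers. -/

namespace LGraph

variable {L V : Type}

theorem sat_congr (G : LGraph L V) (φ : FORFormula L) {s s' : ℕ → V}
    (h : ∀ x ∈ φ.freeVars, s x = s' x) : G.Sat φ s ↔ G.Sat φ s' := by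
  induction φ generalizing s s' with
  | eq x y => simp_all [Sat, FORFormula.freeVars]
  | edge a x y => simp_all [Sat, FORFormula.freeVars]
  | reach S x y => simp_all [Sat, FORFormula.freeVars]
  | neg φ ih => exact not_congr (ih h)
  | and φ ψ ih₁ ih₂ =>
    exact and_congr (ih₁ fun x hx => h x (Finset.mem_union_left _ hx))
      (ih₂ fun x hx => h x (Finset.mem_union_right _ hx))
  | ex x φ ih =>
    refine exists_congr fun v => ih fun y hy => ?_
    rcases eq_or_ne y x with rfl | hyx
    · simp
    · rw [update_of_ne hyx, update_of_ne hyx]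
      exact h y (Finset.mem_erase.2 ⟨hyx, hy⟩)

theorem models_iff_sat (G : LGraph L V) {φ : FORFormula L} (hφ : φ.IsSentence) (s : ℕ → V) :
    G.Models φ ↔ G.Sat φ s :=
  ⟨fun h => h s, fun h s' => (G.sat_congr φ (by rw [hφ]; simp)).1 h⟩

theorem code_mem_theoryFOR [Encodable L] (G : LGraph L V) {φ : FORFormula L}
    (hφ : φ.IsSentence) : φ.code ∈ G.theoryFOR ↔ G.Models φ := by
  constructor
  · rintro ⟨ψ, -, h, hm⟩
    rwa [← FORFormula.code_injective h]
  · exact fun h => ⟨φ, hφ, rfl, h⟩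

/-- The assignment given by a list of bindings of variables to codes of vertices. -/
def assignment (dec : ℕ → V) (env : List (ℕ × ℕ)) (x : ℕ) : V :=
  dec ((env.lookup x).getD 0)

theorem assignment_cons (dec : ℕ → V) (x e : ℕ) (env : List (ℕ × ℕ)) :
    assignment dec ((x, e) :: env) = update (assignment dec env) x (dec e) := by
  funext y
  rcases eq_or_ne y x with rfl | h
  · simp [assignment]
  · have : (y == x) = false := by simpa using h
    simp [assignment, List.lookup_cons, this, h]

/-- The variables bound by a list of bindings. -/
def boundVars (env : List (ℕ × ℕ)) : Finset ℕ := (env.map Prod.fst).toFinset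

@[simp] theorem boundVars_cons (x e : ℕ) (env : List (ℕ × ℕ)) :
    boundVars ((x, e) :: env) = insert x (boundVars env) := by
  simp [boundVars]

theorem mem_boundVars {x : ℕ} {env : List (ℕ × ℕ)} :
    x ∈ boundVars env ↔ ∃ e, env.lookup x = some e := by
  induction env with
  | nil => simp [boundVars]
  | cons p env ih =>
    obtain ⟨y, e⟩ := p
    rw [boundVars_cons, Finset.mem_insert, ih, List.lookup_cons]
    rcases eq_or_ne x y with rfl | h
    · simp
    · have : (x == y) = false := by simpa using h
      simp [this, h]

open Classical in
/-- Three-valued truth: `0` if some free variable is unbound, `1` for false and `2` for true. -/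
noncomputable def truthValue (G : LGraph L V) (dec : ℕ → V) (φ : FORFormula L)
    (env : List (ℕ × ℕ)) : ℕ :=
  if φ.freeVars ⊆ boundVars env then if G.Sat φ (assignment dec env) then 2 else 1 else 0

open Classical in
/-- Three-valued truth as a function of Gödel numbers; invalid numbers yield `0`. -/
noncomputable def codeValue [Encodable L] (G : LGraph L V) (dec : ℕ → V)
    (b : ℕ × List (ℕ × ℕ)) : ℕ :=
  if h : ∃ φ : FORFormula L, φ.code = b.1 then G.truthValue dec h.choose b.2 else 0

theorem codeValue_code [Encodable L] (G : LGraph L V) (dec : ℕ → V) (φ : FORFormula L)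
    (env : List (ℕ × ℕ)) : G.codeValue dec (φ.code, env) = G.truthValue dec φ env := by
  have h : ∃ ψ : FORFormula L, ψ.code = φ.code := ⟨φ, rfl⟩
  simp only [codeValue]
  rw [dif_pos h, FORFormula.code_injective h.choose_spec]

theorem codeValue_of_forall_ne [Encodable L] (G : LGraph L V) (dec : ℕ → V) {n : ℕ}
    (hn : ∀ φ : FORFormula L, φ.code ≠ n) (env : List (ℕ × ℕ)) :
    G.codeValue dec (n, env) = 0 :=
  dif_neg fun ⟨φ, h⟩ => hn φ h

open Classical in
/-- The value of an atom with validity condition `ok` and truth condition `R`. -/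
noncomputable def atomValue (ok : Prop) (R : ℕ → ℕ → Prop) (x y : ℕ)
    (env : List (ℕ × ℕ)) : ℕ :=
  if ok then ((env.lookup x).bind fun e => (env.lookup y).map fun e' =>
    if R e e' then 2 else 1).getD 0 else 0

theorem atomValue_eq_truthValue (G : LGraph L V) (dec : ℕ → V) {φ : FORFormula L} {ok : Prop}
    {R : ℕ → ℕ → Prop} {T : V → V → Prop} {x y : ℕ} (env : List (ℕ × ℕ)) (hok : ok)
    (hfree : φ.freeVars = {x, y}) (hsat : ∀ s, G.Sat φ s ↔ T (s x) (s y))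
    (hR : ∀ e e', R e e' ↔ T (dec e) (dec e')) :
    atomValue ok R x y env = G.truthValue dec φ env := by
  have key : φ.freeVars ⊆ boundVars env ↔
      (∃ e, env.lookup x = some e) ∧ ∃ e, env.lookup y = some e := by
    simp [hfree, Finset.insert_subset_iff, mem_boundVars]
  simp only [atomValue, truthValue, if_pos hok]
  by_cases h : φ.freeVars ⊆ boundVars env
  · obtain ⟨⟨e, he⟩, e', he'⟩ := key.1 h
    simp only [if_pos h, he, he', Option.bind_some, Option.map_some, Option.getD_some]
    have : R e e' ↔ G.Sat φ (assignment dec env) := by simp [hR, hsat, assignment, he, he']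
    by_cases hs : G.Sat φ (assignment dec env) <;> simp [this, hs]
  · rw [if_neg h]
    rw [key] at h
    cases hx : env.lookup x <;> cases hy : env.lookup y <;> simp_all

theorem primrec_atomValue {α : Type} [Primcodable α] {ok : α → Prop} {R : α → ℕ × ℕ → Prop}
    {x y : α → ℕ} {env : α → List (ℕ × ℕ)} (hok : PrimrecPred ok) (hR : PrimrecRel R)
    (hx : Primrec x) (hy : Primrec y) (henv : Primrec env) :
    Primrec fun a => atomValue (ok a) (fun e e' => R a (e, e')) (x a) (y a) (env a) := by
  classical
  refine Primrec.ite hok ?_ (Primrec.const 0)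
  refine Primrec.option_getD.comp ?_ (Primrec.const 0)
  refine Primrec.option_bind (Primrec.listLookup.comp hx henv) ?_
  refine Primrec.option_map (Primrec.listLookup.comp (hy.comp .fst) (henv.comp .fst)) ?_
  exact Primrec.ite (hR.comp (Primrec.fst.comp .fst)
    (Primrec.pair (Primrec.snd.comp .fst) .snd)) (Primrec.const 2) (Primrec.const 1)

theorem _root_.PrimrecPred.exists_finite {α ι : Type} [Primcodable α] [Finite ι]
    {p : ι → α → Prop} (h : ∀ i, PrimrecPred (p i)) : PrimrecPred fun a => ∃ i, p i a := by
  classical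
  have := Fintype.ofFinite ι
  suffices H : ∀ t : Finset ι, PrimrecPred fun a => ∃ i ∈ t, p i a by simpa using H Finset.univ
  intro t
  induction t using Finset.induction with
  | empty =>
    exact (⟨fun _ => isFalse (by simp), by simpa using! Primrec.const false⟩ :
      PrimrecPred fun a => ∃ i ∈ (∅ : Finset ι), p i a)
  | insert i t _ ih => exact ((h i).or ih).of_eq fun a => by simp

theorem _root_.PrimrecPred.forall_finite {α ι : Type} [Primcodable α] [Finite ι]
    {p : ι → α → Prop} (h : ∀ i, PrimrecPred (p i)) : PrimrecPred fun a => ∀ i, p i a :=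
  (PrimrecPred.exists_finite fun i => (h i).not).not.of_eq fun a => by simp

theorem _root_.PrimrecPred.const {α : Type} [Primcodable α] (p : Prop) :
    PrimrecPred fun _ : α => p := by
  classical
  exact ⟨fun _ => inferInstance, Primrec.const _⟩

section Evaluator

variable [Encodable L]

/-- The immediate subformulas of a formula together with the bindings under which they have to be
evaluated; `K` bounds the codes of the vertices tried for a quantifier. -/
def subtasks (K : ℕ × List (ℕ × ℕ) → ℕ) (b : ℕ × List (ℕ × ℕ)) : List (ℕ × List (ℕ × ℕ)) :=
  if b.1.unpair.1 = 3 then [(b.1.unpair.2, b.2)]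
  else if b.1.unpair.1 = 4 then
    [(b.1.unpair.2.unpair.1, b.2), (b.1.unpair.2.unpair.2, b.2)]
  else if b.1.unpair.1 = 5 then
    (List.range (K b + 1)).map fun e =>
      (b.1.unpair.2.unpair.2, (b.1.unpair.2.unpair.1, e) :: b.2)
  else []

/-- The value of a formula, given the values of its subtasks. -/
noncomputable def combine (G : LGraph L V) (dec : ℕ → V) (b : ℕ × List (ℕ × ℕ))
    (l : List ℕ) : ℕ :=
  if b.1.unpair.1 = 0 then
    atomValue True (fun e e' => dec e = dec e') b.1.unpair.2.unpair.1 b.1.unpair.2.unpair.2 b.2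
  else if b.1.unpair.1 = 1 then
    atomValue (∃ a : L, b.1.unpair.2.unpair.1 = Encodable.encode a)
      (fun e e' => ∃ a : L, b.1.unpair.2.unpair.1 = Encodable.encode a ∧
        G.edge a (dec e) (dec e'))
      b.1.unpair.2.unpair.2.unpair.1 b.1.unpair.2.unpair.2.unpair.2 b.2
  else if b.1.unpair.1 = 2 then
    atomValue (∃ S : Finset L, b.1.unpair.2.unpair.1 = Encodable.encode S)
      (fun e e' => ∃ S : Finset L, b.1.unpair.2.unpair.1 = Encodable.encode S ∧
        G.Reach S (dec e) (dec e'))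
      b.1.unpair.2.unpair.2.unpair.1 b.1.unpair.2.unpair.2.unpair.2 b.2
  else if b.1.unpair.1 = 3 then if l.headI = 0 then 0 else 3 - l.headI
  else if b.1.unpair.1 = 4 then min l.headI l.tail.headI
  else if b.1.unpair.1 = 5 then l.foldr max 0
  else 0

theorem foldr_max_eq_zero {l : List ℕ} (h : ∀ a ∈ l, a = 0) : l.foldr max 0 = 0 := by
  induction l with
  | nil => rfl
  | cons a l ih => simp_all

theorem foldr_max_eq_two {l : List ℕ} (h : ∀ a ∈ l, a ≤ 2) (h' : 2 ∈ l) :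
    l.foldr max 0 = 2 := by
  apply le_antisymm
  · clear h'
    induction l with
    | nil => simp
    | cons a l ih => simp_all
  · clear h
    induction l with
    | nil => simp at h'
    | cons a l ih => rcases List.mem_cons.1 h' with rfl | h'' <;> simp_all

theorem foldr_max_eq_one {l : List ℕ} (h : ∀ a ∈ l, a = 1) (h' : l ≠ []) :
    l.foldr max 0 = 1 := by
  induction l with
  | nil => simp at h'
  | cons a l ih => rcases eq_or_ne l [] with rfl | hl <;> simp_all

/-- Correctness of one level of the recursion. The values are chosen so that the undefined value `0`
propagates: negation swaps `1` and `2` by `3 - v` and keeps `0`, conjunction is the minimum, and a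
quantifier is the maximum over the candidates. For the quantifier either all candidates are
undefined or none is, because definedness depends only on which variables are bound. The hypothesis
`hK` makes the finite search complete. -/
theorem combine_subtasks (G : LGraph L V) (dec : ℕ → V) (K : ℕ × List (ℕ × ℕ) → ℕ)
    (hK : ∀ (φ : FORFormula L) (x : ℕ) (env : List (ℕ × ℕ)),
      φ.freeVars ⊆ insert x (boundVars env) → ∀ v,
      G.Sat φ (update (assignment dec env) x v) →
      ∃ e ≤ K ((FORFormula.ex x φ).code, env), G.Sat φ (update (assignment dec env) x (dec e)))
    (b : ℕ × List (ℕ × ℕ)) :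
    G.combine dec b ((subtasks K b).map (G.codeValue dec)) = G.codeValue dec b := by
  obtain ⟨n, env⟩ := b
  by_cases hn : ∃ φ : FORFormula L, φ.code = n
  · obtain ⟨φ, rfl⟩ := hn
    rw [codeValue_code]
    cases φ with
    | eq x y =>
      simp only [combine, subtasks, FORFormula.code, Nat.unpair_pair, if_true]
      exact G.atomValue_eq_truthValue dec (T := fun u v => u = v) env trivial rfl
        (fun _ => Iff.rfl) fun _ _ => Iff.rfl
    | edge a x y =>
      simp only [combine, FORFormula.code, Nat.unpair_pair, if_true, one_ne_zero, if_false]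
      exact G.atomValue_eq_truthValue dec (T := G.edge a) env ⟨a, rfl⟩ rfl
        (fun _ => Iff.rfl) fun _ _ => by simp
    | reach S x y =>
      simp only [combine, FORFormula.code, Nat.unpair_pair, if_true, OfNat.ofNat_ne_zero,
        OfNat.ofNat_ne_one, if_false]
      exact G.atomValue_eq_truthValue dec (T := G.Reach S) env ⟨S, rfl⟩ rfl
        (fun _ => Iff.rfl) fun _ _ => by simp
    | neg φ =>
      simp only [combine, subtasks, FORFormula.code, Nat.unpair_pair]
      norm_num
      rw [codeValue_code]
      simp only [truthValue, FORFormula.freeVars, Sat]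
      split_ifs <;> simp_all
    | and φ ψ =>
      simp only [combine, subtasks, FORFormula.code, Nat.unpair_pair]
      norm_num
      rw [codeValue_code, codeValue_code]
      simp only [truthValue, FORFormula.freeVars, Sat, Finset.union_subset_iff]
      split_ifs <;> simp_all
    | ex x φ =>
      have hval : G.combine dec ((FORFormula.ex x φ).code, env)
          ((subtasks K ((FORFormula.ex x φ).code, env)).map (G.codeValue dec)) =
          ((List.range (K ((FORFormula.ex x φ).code, env) + 1)).map fun e =>
            G.truthValue dec φ ((x, e) :: env)).foldr max 0 := by
        simp only [combine, subtasks]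
        simp only [FORFormula.code, Nat.unpair_pair]
        norm_num
        simp only [← codeValue_code]
        rfl
      rw [hval]
      have hfree : (FORFormula.ex x φ).freeVars ⊆ boundVars env ↔
          φ.freeVars ⊆ insert x (boundVars env) := by
        rw [FORFormula.freeVars, ← Finset.subset_insert_iff]
      simp only [truthValue, boundVars_cons, hfree]
      by_cases hf : φ.freeVars ⊆ insert x (boundVars env)
      · simp only [hf, if_true]
        by_cases hs : G.Sat (FORFormula.ex x φ) (assignment dec env)
        · rw [if_pos hs]
          obtain ⟨v, hv⟩ := hs
          obtain ⟨e, he, hse⟩ := hK φ x env hf v hv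
          refine foldr_max_eq_two (fun a ha => ?_) ?_
          · obtain ⟨e, -, rfl⟩ := List.mem_map.1 ha
            split_ifs <;> simp
          · exact List.mem_map.2 ⟨e, List.mem_range.2 (Nat.lt_succ_of_le he), if_pos (by rwa [assignment_cons])⟩
        · rw [if_neg hs]
          refine foldr_max_eq_one (fun a ha => ?_) (by simp)
          obtain ⟨e, -, rfl⟩ := List.mem_map.1 ha
          exact if_neg fun h => hs ⟨_, by rwa [assignment_cons] at h⟩
      · simp only [hf, if_false]
        exact foldr_max_eq_zero fun a ha => by simp_all
  -- If `n` is not a Gödel number, its tag is too large or one of its components is no code;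
  -- otherwise the components could be reassembled to a formula with code `n`.
  · push Not at hn
    rw [codeValue_of_forall_ne G dec hn]
    simp only [combine]
    have hpair : ∀ t r, n.unpair.1 = t → n.unpair.2 = r → Nat.pair t r = n := by
      rintro _ _ rfl rfl; exact Nat.pair_unpair n
    split_ifs with h0 h1 h2 h3 h3' h4 h5
    · exact absurd (by rw [FORFormula.code, Nat.pair_unpair]; exact hpair 0 _ h0 rfl)
        (hn (.eq n.unpair.2.unpair.1 n.unpair.2.unpair.2))
    · refine if_neg ?_
      rintro ⟨a, ha⟩
      refine absurd ?_
        (hn (.edge a n.unpair.2.unpair.2.unpair.1 n.unpair.2.unpair.2.unpair.2))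
      rw [FORFormula.code, Nat.pair_unpair, ← ha, Nat.pair_unpair]
      exact hpair 1 _ h1 rfl
    · refine if_neg ?_
      rintro ⟨a, ha⟩
      refine absurd ?_
        (hn (.reach a n.unpair.2.unpair.2.unpair.1 n.unpair.2.unpair.2.unpair.2))
      rw [FORFormula.code, Nat.pair_unpair, ← ha, Nat.pair_unpair]
      exact hpair 2 _ h2 rfl
    · rfl
    · refine absurd ?_ h3'
      simp only [subtasks, h3, if_true, List.map_cons, List.headI_cons]
      refine codeValue_of_forall_ne G dec (fun φ hφ => ?_) _
      exact hn (.neg φ) (by rw [FORFormula.code, hφ]; exact hpair 3 _ h3 rfl)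
    · simp only [subtasks, h4, if_true]
      by_cases hφ : ∃ φ : FORFormula L, φ.code = n.unpair.2.unpair.1
      · obtain ⟨φ, hφ⟩ := hφ
        have : ∀ ψ : FORFormula L, ψ.code ≠ n.unpair.2.unpair.2 := fun ψ hψ =>
          hn (.and φ ψ) (by
            rw [FORFormula.code, hφ, hψ, Nat.pair_unpair]; exact hpair 4 _ h4 rfl)
        simp [codeValue_of_forall_ne G dec this]
      · push Not at hφ
        simp [codeValue_of_forall_ne G dec hφ]
    · refine foldr_max_eq_zero fun a ha => ?_
      simp only [subtasks, h5, if_true] at ha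
      simp only [Nat.reduceEqDiff, if_false, List.map_map, List.mem_map, comp_apply] at ha
      obtain ⟨e, -, rfl⟩ := ha
      refine codeValue_of_forall_ne G dec (fun φ hφ => ?_) _
      exact hn (.ex n.unpair.2.unpair.1 φ) (by
        rw [FORFormula.code, hφ, Nat.pair_unpair]; exact hpair 5 _ h5 rfl)
    · rfl

theorem primrec_subtasks {K : ℕ × List (ℕ × ℕ) → ℕ} (hK : Primrec K) :
    Primrec (subtasks K) := by
  have hn : Primrec fun b : ℕ × List (ℕ × ℕ) => b.1.unpair :=
    Primrec.unpair.comp .fst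
  have htag (t : ℕ) : PrimrecPred fun b : ℕ × List (ℕ × ℕ) => b.1.unpair.1 = t :=
    Primrec.eq.comp (Primrec.fst.comp hn) (Primrec.const t)
  have h2 : Primrec fun b : ℕ × List (ℕ × ℕ) => b.1.unpair.2 := Primrec.snd.comp hn
  have h21 : Primrec fun b : ℕ × List (ℕ × ℕ) => b.1.unpair.2.unpair.1 :=
    Primrec.fst.comp (Primrec.unpair.comp h2)
  have h22 : Primrec fun b : ℕ × List (ℕ × ℕ) => b.1.unpair.2.unpair.2 :=
    Primrec.snd.comp (Primrec.unpair.comp h2)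
  refine Primrec.ite (htag 3) (Primrec.list_cons.comp (h2.pair .snd) (Primrec.const [])) ?_
  refine Primrec.ite (htag 4) (Primrec.list_cons.comp (h21.pair .snd)
    (Primrec.list_cons.comp (h22.pair .snd) (Primrec.const []))) ?_
  refine Primrec.ite (htag 5) ?_ (Primrec.const [])
  refine Primrec.list_map (Primrec.list_range.comp (Primrec.succ.comp hK)) ?_
  exact Primrec.pair (h22.comp .fst) (Primrec.list_cons.comp
    (Primrec.pair (h21.comp .fst) .snd) (Primrec.snd.comp .fst))

theorem primrec_combine [Finite L] (G : LGraph L V) (dec : ℕ → V)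
    (heq : PrimrecRel fun e e' => dec e = dec e')
    (hedge : ∀ a, PrimrecRel fun e e' => G.edge a (dec e) (dec e'))
    (hreach : ∀ S, PrimrecRel fun e e' => G.Reach S (dec e) (dec e')) :
    Primrec₂ (G.combine dec) := by
  have hn : Primrec fun p : (ℕ × List (ℕ × ℕ)) × List ℕ => p.1.1.unpair :=
    Primrec.unpair.comp (Primrec.fst.comp .fst)
  have htag (t : ℕ) : PrimrecPred fun p : (ℕ × List (ℕ × ℕ)) × List ℕ => p.1.1.unpair.1 = t :=
    Primrec.eq.comp (Primrec.fst.comp hn) (Primrec.const t)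
  have h2 : Primrec fun p : (ℕ × List (ℕ × ℕ)) × List ℕ => p.1.1.unpair.2 := Primrec.snd.comp hn
  have h21 : Primrec fun p : (ℕ × List (ℕ × ℕ)) × List ℕ => p.1.1.unpair.2.unpair.1 :=
    Primrec.fst.comp (Primrec.unpair.comp h2)
  have h22 : Primrec fun p : (ℕ × List (ℕ × ℕ)) × List ℕ => p.1.1.unpair.2.unpair.2 :=
    Primrec.snd.comp (Primrec.unpair.comp h2)
  have h221 : Primrec fun p : (ℕ × List (ℕ × ℕ)) × List ℕ => p.1.1.unpair.2.unpair.2.unpair.1 :=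
    Primrec.fst.comp (Primrec.unpair.comp h22)
  have h222 : Primrec fun p : (ℕ × List (ℕ × ℕ)) × List ℕ => p.1.1.unpair.2.unpair.2.unpair.2 :=
    Primrec.snd.comp (Primrec.unpair.comp h22)
  have henv : Primrec fun p : (ℕ × List (ℕ × ℕ)) × List ℕ => p.1.2 := Primrec.snd.comp .fst
  have hhead : Primrec fun p : (ℕ × List (ℕ × ℕ)) × List ℕ => p.2.headI :=
    Primrec.list_headI.comp .snd
  -- There are finitely many labels, and finitely many sets of labels, so the existential over them
  -- is a finite disjunction of primitive recursive conditions.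
  have hlabel {ι : Type} [Encodable ι] [Finite ι] {R : ι → ℕ → ℕ → Prop}
      (hR : ∀ i, PrimrecRel (R i)) :
      Primrec fun p : (ℕ × List (ℕ × ℕ)) × List ℕ =>
        atomValue (∃ i : ι, p.1.1.unpair.2.unpair.1 = Encodable.encode i)
          (fun e e' => ∃ i : ι, p.1.1.unpair.2.unpair.1 = Encodable.encode i ∧ R i e e')
          p.1.1.unpair.2.unpair.2.unpair.1 p.1.1.unpair.2.unpair.2.unpair.2 p.1.2 := by
    refine primrec_atomValue
      (R := fun p e => ∃ i : ι, p.1.1.unpair.2.unpair.1 = Encodable.encode i ∧ R i e.1 e.2)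
      (PrimrecPred.exists_finite fun i : ι => Primrec.eq.comp h21 (Primrec.const _))
      (PrimrecPred.exists_finite fun i : ι => PrimrecPred.and ?_ ?_) h221 h222 henv
    · exact Primrec.eq.comp (h21.comp .fst) (Primrec.const _)
    · exact (hR i).comp (Primrec.fst.comp .snd) (Primrec.snd.comp .snd)
  refine Primrec.ite (htag 0) ?_ ?_
  · exact primrec_atomValue (R := fun _ e => dec e.1 = dec e.2) (PrimrecPred.const True)
      (heq.comp (Primrec.fst.comp .snd) (Primrec.snd.comp .snd)) h21 h22 henv
  refine Primrec.ite (htag 1) (hlabel hedge) ?_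
  refine Primrec.ite (htag 2) (hlabel hreach) ?_
  refine Primrec.ite (htag 3) (Primrec.ite (Primrec.eq.comp hhead (Primrec.const 0))
    (Primrec.const 0) (Primrec.nat_sub.comp (Primrec.const 3) hhead)) ?_
  refine Primrec.ite (htag 4) (Primrec.nat_min.comp hhead
    (Primrec.list_headI.comp (Primrec.list_tail.comp .snd))) ?_
  refine Primrec.ite (htag 5) (Primrec.list_foldr (h := fun _ q => max q.1 q.2) .snd (Primrec.const 0) ?_) (Primrec.const 0)
  exact Primrec.nat_max.comp (Primrec.fst.comp .snd) (Primrec.snd.comp .snd)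

/-- A graph with finitely many labels has a decidable FO(R)-theory if its vertices can be numbered
so that the atomic relations are primitive recursive and witnesses for quantifiers can be bounded
by a primitive recursive function. -/
theorem hasDecidableFOR_of_bounded_witnesses [Finite L] (G : LGraph L V) (dec : ℕ → V)
    (heq : PrimrecRel fun e e' => dec e = dec e')
    (hedge : ∀ a, PrimrecRel fun e e' => G.edge a (dec e) (dec e'))
    (hreach : ∀ S, PrimrecRel fun e e' => G.Reach S (dec e) (dec e'))
    {K : ℕ × List (ℕ × ℕ) → ℕ} (hKprim : Primrec K)
    (hK : ∀ (φ : FORFormula L) (x : ℕ) (env : List (ℕ × ℕ)),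
      φ.freeVars ⊆ insert x (boundVars env) → ∀ v,
      G.Sat φ (update (assignment dec env) x v) →
      ∃ e ≤ K ((FORFormula.ex x φ).code, env),
        G.Sat φ (update (assignment dec env) x (dec e))) :
    G.HasDecidableFOR := by
  -- Course-of-values recursion along the Gödel number; the list of bindings is a parameter that may
  -- grow.
  have hval : Primrec (G.codeValue dec) := by
    refine Primrec.nat_omega_rec' (G.codeValue dec) (m := Prod.fst) (l := subtasks K)
      (g := fun b l => some (G.combine dec b l)) Primrec.fst (primrec_subtasks hKprim)
      (Primrec.option_some.comp₂ (G.primrec_combine dec heq hedge hreach)) ?_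
      fun b => congrArg some (G.combine_subtasks dec K hK b)
    -- Subtasks exist only for the tags 3, 4 and 5. As `a + b ≤ Nat.pair a b`, a positive tag makes
    -- the codes of the subtasks strictly smaller.
    intro b b' hb'
    have h₁ := Nat.add_le_pair b.1.unpair.1 b.1.unpair.2
    have h₂ := Nat.add_le_pair b.1.unpair.2.unpair.1 b.1.unpair.2.unpair.2
    rw [Nat.pair_unpair] at h₁ h₂
    unfold subtasks at hb'
    split_ifs at hb'
    · simp only [List.mem_singleton] at hb'
      subst hb'
      dsimp only
      omega
    · simp only [List.mem_cons, List.not_mem_nil, or_false] at hb'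
      rcases hb' with rfl | rfl <;> dsimp only <;> omega
    · obtain ⟨e, -, rfl⟩ := List.mem_map.1 hb'
      dsimp only
      omega
    · simp at hb'
  have hpred : PrimrecPred fun n : ℕ => G.codeValue dec (n, []) = 2 :=
    Primrec.eq.comp (hval.comp (Primrec.pair .id (Primrec.const []))) (Primrec.const 2)
  -- With no bindings, a formula with a free variable gets the value `0`, so the value `2` singles
  -- out the true sentences.
  have hmem (n : ℕ) : G.codeValue dec (n, []) = 2 ↔ n ∈ G.theoryFOR := by
    by_cases hn : ∃ φ : FORFormula L, φ.code = n
    · obtain ⟨φ, rfl⟩ := hn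
      rw [codeValue_code, truthValue]
      by_cases hφ : φ.IsSentence
      · have h0 : φ.freeVars ⊆ boundVars [] := by rw [hφ]; simp
        rw [G.code_mem_theoryFOR hφ, G.models_iff_sat hφ (assignment dec []), if_pos h0]
        split_ifs with h <;> simp [h]
      · have h0 : ¬ φ.freeVars ⊆ boundVars [] := fun h => hφ (Finset.subset_empty.1 h)
        rw [if_neg h0]
        refine iff_of_false (by simp) ?_
        rintro ⟨ψ, hψ, h, -⟩
        exact hφ (FORFormula.code_injective h ▸ hψ)
    · refine iff_of_false ?_ fun ⟨φ, _, h, _⟩ => hn ⟨φ, h⟩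
      push Not at hn
      simp [codeValue_of_forall_ne G dec hn]
  obtain ⟨_, h⟩ := hpred.of_eq hmem
  exact ⟨_, h.to_comp⟩

end Evaluator

/-! ### Finite graphs, and invariance under isomorphism. -/

theorem primrec_finOfNat (n : ℕ) [NeZero n] : Primrec (Fin.ofNat n) :=
  Primrec.fin_val_iff.1 (Primrec.nat_mod.comp .id (Primrec.const n))

theorem primrecRel_of_finite {n : ℕ} [NeZero n] (R : Fin n → Fin n → Prop) :
    PrimrecRel fun e e' => R (Fin.ofNat n e) (Fin.ofNat n e') := by
  classical
  have : PrimrecRel R := ⟨fun _ => inferInstance, Primrec.dom_finite _⟩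
  exact this.comp ((primrec_finOfNat n).comp .fst) ((primrec_finOfNat n).comp .snd)

theorem hasDecidableFOR_of_finite [Finite L] [Encodable L] [Finite V] [Nonempty V]
    (G : LGraph L V) : G.HasDecidableFOR := by
  have : NeZero (Nat.card V) := ⟨Nat.card_pos.ne'⟩
  let e := Finite.equivFin V
  refine G.hasDecidableFOR_of_bounded_witnesses (fun n => e.symm (Fin.ofNat _ n))
    (primrecRel_of_finite fun u v => e.symm u = e.symm v)
    (fun a => primrecRel_of_finite fun u v => G.edge a (e.symm u) (e.symm v))
    (fun S => primrecRel_of_finite fun u v => G.Reach S (e.symm u) (e.symm v))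
    (Primrec.const (Nat.card V)) fun φ x env _ v hv => ⟨e v, (e v).2.le, ?_⟩
  simpa using hv

/-- An isomorphism of labeled graphs preserves satisfaction. -/
theorem sat_equiv {V' : Type} (G : LGraph L V) (H : LGraph L V') (e : V ≃ V')
    (he : ∀ a u v, G.edge a u v ↔ H.edge a (e u) (e v)) (φ : FORFormula L) (s : ℕ → V) :
    G.Sat φ s ↔ H.Sat φ (e ∘ s) := by
  induction φ generalizing s with
  | eq x y => simp [Sat]
  | edge a x y => exact he a _ _
  | reach S x y =>
    constructor
    · exact fun h => Relation.ReflTransGen.lift (p := fun u v => ∃ a ∈ S, H.edge a u v) e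
        (fun u v ⟨a, ha, h⟩ => ⟨a, ha, (he a u v).1 h⟩) _ _ h
    · intro h
      have := Relation.ReflTransGen.lift (p := fun u v => ∃ a ∈ S, G.edge a u v) e.symm
        (fun u v ⟨a, ha, h⟩ => ⟨a, ha, (he a _ _).2 (by simpa using h)⟩) _ _ h
      simpa [onFun] using! this
  | neg φ ih => exact not_congr (ih s)
  | and φ ψ ih₁ ih₂ => exact and_congr (ih₁ s) (ih₂ s)
  | ex x φ ih =>
    have key (v : V) : e ∘ update s x v = update (e ∘ s) x (e v) := by
      funext y
      rcases eq_or_ne y x with rfl | h <;> simp [*]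
    constructor
    · rintro ⟨v, hv⟩
      exact ⟨e v, by rw [← key]; exact (ih _).1 hv⟩
    · rintro ⟨v, hv⟩
      exact ⟨e.symm v, (ih _).2 (by rw [key]; simpa using hv)⟩

theorem models_equiv {V' : Type} (G : LGraph L V) (H : LGraph L V') (e : V ≃ V')
    (he : ∀ a u v, G.edge a u v ↔ H.edge a (e u) (e v)) (φ : FORFormula L) :
    G.Models φ ↔ H.Models φ := by
  constructor
  · intro h s
    have := (G.sat_equiv H e he φ (e.symm ∘ s)).1 (h _)
    simpa [← Function.comp_assoc] using this
  · exact fun h s => (G.sat_equiv H e he φ s).2 (h _)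

theorem hasDecidableFOR_equiv {V' : Type} [Encodable L] (G : LGraph L V) (H : LGraph L V')
    (e : V ≃ V') (he : ∀ a u v, G.edge a u v ↔ H.edge a (e u) (e v))
    (h : H.HasDecidableFOR) : G.HasDecidableFOR := by
  have : G.theoryFOR = H.theoryFOR := by
    ext n
    simp only [theoryFOR, G.models_equiv H e he]
  rw [HasDecidableFOR, this]
  exact h

end LGraph

/-! ### Counter graphs and the coordinatewise form of their edges and reachability. -/

/-- Operations on a family of counters indexed by `ι`. -/
inductive CounterOp (ι : Type) : Type
  | nop
  | inc (i : ι)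
  | dec (i : ι)
  | zero (i : ι)
  | stuck

namespace CounterOp

variable {ι : Type} [DecidableEq ι]

/-- The effect of an operation: `zero` tests a counter for zero and `stuck` is never possible. -/
def Rel : CounterOp ι → (ι → ℕ) → (ι → ℕ) → Prop
  | nop, c, c' => c' = c
  | inc i, c, c' => c' = update c i (c i + 1)
  | dec i, c, c' => c i ≠ 0 ∧ c' = update c i (c i - 1)
  | zero i, c, c' => c i = 0 ∧ c' = c
  | stuck, _, _ => False

theorem Rel.unique {op : CounterOp ι} {c c₁ c₂ : ι → ℕ} (h₁ : op.Rel c c₁) (h₂ : op.Rel c c₂) :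
    c₁ = c₂ := by
  cases op <;> simp_all [Rel]

end CounterOp

/-- The asynchronous product of a finite control and finitely many counters: for each transition
`(q, op, q')` there is one label for the change of state and one for the operation. -/
def counterGraph {Q ι τ : Type} [DecidableEq ι] (T : τ → Q × CounterOp ι × Q) :
    LGraph (τ ⊕ τ) (Q × (ι → ℕ)) where
  edge
    | .inl j, u, v => u.1 = (T j).1 ∧ v.1 = (T j).2.2 ∧ v.2 = u.2
    | .inr j, u, v => v.1 = u.1 ∧ (T j).2.1.Rel u.2 v.2

/-- A relation between numbers which only depends on truncated sizes and differences. -/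
def IsTruncated (r : ℕ → ℕ → Prop) : Prop :=
  ∀ x y x' y', min x 2 = min x' 2 → min y 2 = min y' 2 → min (x - y) 2 = min (x' - y') 2 →
    min (y - x) 2 = min (y' - x') 2 → r x y → r x' y'

/-- The four truncated quantities take finitely many values, so `r` is the preimage of a subset of a
finite type under a primitive recursive map. -/
theorem IsTruncated.primrecRel {r : ℕ → ℕ → Prop} (hr : IsTruncated r) : PrimrecRel r := by
  classical
  let type (p : ℕ × ℕ) : (Fin 3 × Fin 3) × (Fin 3 × Fin 3) :=
    ((Fin.ofNat 3 (min p.1 2), Fin.ofNat 3 (min p.2 2)),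
      (Fin.ofNat 3 (min (p.1 - p.2) 2), Fin.ofNat 3 (min (p.2 - p.1) 2)))
  have hmin {f : ℕ × ℕ → ℕ} (hf : Primrec f) : Primrec fun p => Fin.ofNat 3 (min (f p) 2) :=
    (LGraph.primrec_finOfNat 3).comp (Primrec.nat_min.comp hf (Primrec.const 2))
  have htype : Primrec type :=
    ((hmin .fst).pair (hmin .snd)).pair ((hmin Primrec.nat_sub).pair
      (hmin (Primrec.nat_sub.comp .snd .fst)))
  have hfin : PrimrecPred fun t => ∃ p : ℕ × ℕ, type p = t ∧ r p.1 p.2 :=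
    ⟨fun _ => inferInstance, Primrec.dom_finite _⟩
  refine (hfin.comp htype).of_eq fun p => ⟨?_, fun h => ⟨p, rfl, h⟩⟩
  rintro ⟨p', h, hp⟩
  have hlt (n : ℕ) : min n 2 < 3 := by omega
  simp only [type, Prod.mk.injEq, Fin.ext_iff, Fin.ofNat, Nat.mod_eq_of_lt (hlt _)] at h
  exact hr _ _ _ _ h.1.1 h.1.2 h.2.1 h.2.2 hp

/-- A relation between states with counters which is a conjunction of a condition on the states and
of truncated conditions on the single counters. -/
def IsCoordinatewise {Q ι : Type} (R : Q × (ι → ℕ) → Q × (ι → ℕ) → Prop) : Prop :=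
  ∃ (A : Q → Q → Prop) (r : ι → ℕ → ℕ → Prop), (∀ i, IsTruncated (r i)) ∧
    ∀ u v, R u v ↔ A u.1 v.1 ∧ ∀ i, r i (u.2 i) (v.2 i)

theorem isCoordinatewise_eq {Q ι : Type} :
    IsCoordinatewise (fun u v : Q × (ι → ℕ) => u = v) :=
  ⟨Eq, fun _ => Eq, fun _ _ _ _ _ _ _ _ _ _ => by omega, fun u v => by
    simp only [Prod.ext_iff, funext_iff]⟩

section CounterGraph

variable {Q ι τ : Type} [DecidableEq ι] (T : τ → Q × CounterOp ι × Q)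

/-- Truncation at 2 is what the increments and decrements need: a difference of exactly 1 has to be
told from a larger one. -/
theorem isCoordinatewise_edge (a : τ ⊕ τ) : IsCoordinatewise ((counterGraph T).edge a) := by
  have hEq : IsTruncated Eq := fun _ _ _ _ _ _ _ _ _ => by omega
  have hupd (i : ι) (f : ℕ → ℕ) (c c' : ι → ℕ) : c' = update c i (f (c i)) ↔
      ∀ i', if i' = i then c' i' = f (c i') else c' i' = c i' := by
    rw [funext_iff]
    refine forall_congr' fun i' => ?_
    rcases eq_or_ne i' i with rfl | h <;> simp [*]
  cases a with
  | inl j =>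
    refine ⟨fun q q' => q = (T j).1 ∧ q' = (T j).2.2, fun _ => Eq, fun _ => hEq, fun u v => ?_⟩
    simp only [counterGraph, and_assoc, funext_iff, eq_comm]
  | inr j =>
    rcases hop : (T j).2.1 with _ | i | i | i | _
    · refine ⟨fun q q' => q' = q, fun _ => Eq, fun _ => hEq, fun u v => ?_⟩
      simp only [counterGraph, hop, CounterOp.Rel, funext_iff, eq_comm]
    · refine ⟨fun q q' => q' = q, fun i' x y => if i' = i then y = x + 1 else y = x,
        fun i' x y x' y' _ _ _ _ => by dsimp only; split_ifs <;> omega, fun u v => ?_⟩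
      simp only [counterGraph, hop, CounterOp.Rel]
      rw [hupd i (· + 1)]
    · refine ⟨fun q q' => q' = q, fun i' x y => if i' = i then x ≠ 0 ∧ y = x - 1 else y = x,
        fun i' x y x' y' _ _ _ _ => by dsimp only; split_ifs <;> omega, fun u v => ?_⟩
      simp only [counterGraph, hop, CounterOp.Rel]
      rw [hupd i (· - 1)]
      -- The guard `c i ≠ 0` is absorbed into the condition on coordinate `i`, where it belongs in a
      -- coordinatewise description.
      refine and_congr_right fun _ => ⟨fun ⟨h, h'⟩ i' => ?_, fun h => ⟨?_, fun i' => ?_⟩⟩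
      · have := h' i'
        split_ifs with hi
        · subst hi; simp_all
        · simp_all
      · have := h i
        simp_all
      · have := h i'
        split_ifs with hi <;> simp_all
    · refine ⟨fun q q' => q' = q, fun i' x y => (i' = i → x = 0) ∧ y = x,
        fun i' x y x' y' _ _ _ _ => ?_, fun u v => ?_⟩
      · rintro ⟨h, h'⟩
        exact ⟨fun hi => by have := h hi; omega, by omega⟩
      · simp only [counterGraph, hop, CounterOp.Rel, funext_iff, forall_and]
        simp
    · refine ⟨fun _ _ => False, fun _ => Eq, fun _ => hEq, fun u v => ?_⟩
      simp [counterGraph, hop, CounterOp.Rel]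

variable {T}

/-- Some transition with the operation `op` has the label of its operation in `S`. -/
def HasOp (T : τ → Q × CounterOp ι × Q) (S : Finset (τ ⊕ τ)) (op : CounterOp ι) : Prop :=
  ∃ j, .inr j ∈ S ∧ (T j).2.1 = op

theorem reach_update {S : Finset (τ ⊕ τ)} (q : Q) (c : ι → ℕ) (i : ι) (y : ℕ)
    (hup : y ≤ c i ∨ HasOp T S (.inc i)) (hdown : c i ≤ y ∨ HasOp T S (.dec i)) :
    (counterGraph T).Reach S (q, c) (q, update c i y) := by
  rcases le_total (c i) y with h | h
  · rcases hup with h' | ⟨j, hj, hop⟩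
    · rw [le_antisymm h' h, update_eq_self]
      exact .refl
    · clear hdown
      induction y, h using Nat.le_induction with
      | base => rw [update_eq_self]; exact .refl
      | succ y _ ih =>
        refine ih.tail ⟨_, hj, rfl, ?_⟩
        simp [hop, CounterOp.Rel]
  · rcases hdown with h' | ⟨j, hj, hop⟩
    · rw [le_antisymm h h', update_eq_self]
      exact .refl
    · clear hup
      obtain ⟨d, hd⟩ := Nat.exists_eq_add_of_le h
      induction d generalizing y with
      | zero => rw [show y = c i by omega, update_eq_self]; exact .refl
      | succ d ih =>
        refine (ih (y + 1) (by omega) (by omega)).tail ⟨_, hj, rfl, ?_⟩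
        simp [hop, CounterOp.Rel]

/-- Labels that change the state ignore the counters, and labels of operations ignore the state, so
the steps of a path can be regrouped by component. A counter can then rise to any value once an
increment is available and fall to any value once a decrement is. Zero tests change nothing and
contribute nothing to reachability. -/
theorem counterGraph_reach_iff [Finite ι] (S : Finset (τ ⊕ τ)) (u v : Q × (ι → ℕ)) :
    (counterGraph T).Reach S u v ↔
      Relation.ReflTransGen (fun q q' => ∃ j, .inl j ∈ S ∧ q = (T j).1 ∧ q' = (T j).2.2)
        u.1 v.1 ∧
      ∀ i, (v.2 i ≤ u.2 i ∨ HasOp T S (.inc i)) ∧ (u.2 i ≤ v.2 i ∨ HasOp T S (.dec i)) := by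
  have := Fintype.ofFinite ι
  constructor
  · intro h
    induction h with
    | refl => exact ⟨.refl, fun i => ⟨.inl le_rfl, .inl le_rfl⟩⟩
    | @tail v w _ hvw ih =>
      obtain ⟨a, ha, h⟩ := hvw
      cases a with
      | inl j =>
        obtain ⟨h₁, h₂, h₃⟩ := h
        exact ⟨ih.1.tail ⟨j, ha, h₁, h₂⟩, by rw [h₃]; exact ih.2⟩
      | inr j =>
        obtain ⟨h₁, h₂⟩ := h
        refine ⟨by rw [h₁]; exact ih.1, fun i => ?_⟩
        have key : (w.2 i ≤ v.2 i ∨ HasOp T S (.inc i)) ∧ (v.2 i ≤ w.2 i ∨ HasOp T S (.dec i)) := by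
          rcases hop : (T j).2.1 with _ | i' | i' | i' | _ <;> rw [hop] at h₂ <;>
            simp only [CounterOp.Rel] at h₂
          · simp [h₂]
          · rcases eq_or_ne i i' with rfl | hi
            · exact ⟨.inr ⟨j, ha, hop⟩, .inl (by simp [h₂])⟩
            · simp [h₂, hi]
          · rcases eq_or_ne i i' with rfl | hi
            · exact ⟨.inl (by simp [h₂]), .inr ⟨j, ha, hop⟩⟩
            · simp [h₂, hi]
          · simp [h₂]
        have := ih.2 i
        constructor
        · rcases key.1 with h | h
          · rcases this.1 with h' | h'
            exacts [.inl (h.trans h'), .inr h']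
          · exact .inr h
        · rcases key.2 with h | h
          · rcases this.2 with h' | h'
            exacts [.inl (h'.trans h), .inr h']
          · exact .inr h
  · rintro ⟨hq, hc⟩
    obtain ⟨q, c⟩ := u
    obtain ⟨q', c'⟩ := v
    have h₁ : (counterGraph T).Reach S (q, c) (q', c) :=
      Relation.ReflTransGen.lift (p := fun u v => ∃ a ∈ S, (counterGraph T).edge a u v)
        (fun q => (q, c)) (fun _ _ ⟨j, hj, h, h'⟩ => ⟨_, hj, h, h', rfl⟩) _ _ hq
    -- The counters are adjusted one after the other; `t` is the set of those that already have
    -- their final value.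
    have h₂ (t : Finset ι) : (counterGraph T).Reach S (q', c) (q', t.piecewise c' c) := by
      induction t using Finset.induction with
      | empty => rw [Finset.piecewise_empty]; exact .refl
      | insert i t hi ih =>
        rw [Finset.piecewise_insert]
        refine ih.trans (reach_update _ _ _ _ ?_ ?_) <;>
          rw [Finset.piecewise_eq_of_notMem _ _ _ hi]
        exacts [(hc i).1, (hc i).2]
    have := h₁.trans (h₂ Finset.univ)
    rwa [Finset.piecewise_univ] at this

theorem isCoordinatewise_reach [Finite ι] (S : Finset (τ ⊕ τ)) :
    IsCoordinatewise ((counterGraph T).Reach S) := by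
  refine ⟨_, fun i x y => (y ≤ x ∨ HasOp T S (.inc i)) ∧ (x ≤ y ∨ HasOp T S (.dec i)),
    fun i x y x' y' _ _ _ _ h => ?_, counterGraph_reach_iff S⟩
  exact ⟨h.1.imp_left fun _ => by omega, h.2.imp_left fun _ => by omega⟩

end CounterGraph

/-! ### The Ehrenfeucht-Fraïssé game on states with counters. -/

/-- Two families of numbers agree, up to the threshold `D`, in sizes and differences on `X`. -/
def NatSim (D : ℕ) (X : Finset ℕ) (a a' : ℕ → ℕ) : Prop :=
  (∀ x ∈ X, min (a x) D = min (a' x) D) ∧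
    ∀ x ∈ X, ∀ y ∈ X, min (a x - a y) D = min (a' x - a' y) D

/-- One round of the game, which halves the threshold. A small `v` is copied, and a `v` at distance
less than `D` from some `a p` is copied relative to `a' p`. A `v` far from everything goes to
distance `D` above the image of the greatest `a p` below it, or to `D` if there is none. This is
safe because the gap around `v` has length at least `2 * D`, hence so has the corresponding gap on
the other side. The bound on `v'` is what later makes witnesses searchable. -/
theorem NatSim.extend {D : ℕ} {X : Finset ℕ} {a a' : ℕ → ℕ} (h : NatSim (2 * D) X a a')
    (v : ℕ) : ∃ v', (v' ≤ D ∨ ∃ y ∈ X, v' ≤ a' y + D) ∧ min v D = min v' D ∧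
      ∀ y ∈ X, min (v - a y) D = min (v' - a' y) D ∧ min (a y - v) D = min (a' y - v') D := by
  obtain ⟨h₁, h₂⟩ := h
  by_cases hv : v < D
  · refine ⟨v, .inl hv.le, rfl, fun y hy => ?_⟩
    have := h₁ y hy
    omega
  by_cases hp : ∃ p ∈ X, v < a p + D ∧ a p < v + D
  · obtain ⟨p, hp, hp₁, hp₂⟩ := hp
    have := h₁ p hp
    refine ⟨a' p + v - a p, .inr ⟨p, hp, by omega⟩, by omega, fun y hy => ?_⟩
    have := h₂ p hp y hy
    have := h₂ y hy p hp
    omega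
  · push Not at hp
    by_cases he : ∃ p ∈ X, a p ≤ v
    · obtain ⟨p₀, hp₀, hle⟩ := he
      obtain ⟨p, hpX, hmax⟩ := (X.filter fun p => a p ≤ v).exists_max_image a
        ⟨p₀, Finset.mem_filter.2 ⟨hp₀, hle⟩⟩
      rw [Finset.mem_filter] at hpX
      have hpv := hp p hpX.1
      refine ⟨a' p + D, .inr ⟨p, hpX.1, le_rfl⟩, by omega, fun y hy => ?_⟩
      have hyv := hp y hy
      have := h₂ p hpX.1 y hy
      have := h₂ y hy p hpX.1
      by_cases hay : a y ≤ v
      · have := hmax y (Finset.mem_filter.2 ⟨hy, hay⟩)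
        omega
      · omega
    · push Not at he
      refine ⟨D, .inl le_rfl, by omega, fun y hy => ?_⟩
      have := h₁ y hy
      have := hp y hy
      have := he y hy
      omega

/-- Similarity of assignments of states with counters. -/
def StateSim {Q ι : Type} (D : ℕ) (X : Finset ℕ) (s s' : ℕ → Q × (ι → ℕ)) : Prop :=
  (∀ x ∈ X, (s x).1 = (s' x).1) ∧ ∀ i, NatSim D X (fun x => (s x).2 i) (fun x => (s' x).2 i)

section StateSim

variable {Q ι L : Type}

theorem StateSim.mono {D D' : ℕ} {X X' : Finset ℕ} {s s' : ℕ → Q × (ι → ℕ)}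
    (h : StateSim D X s s') (hD : D' ≤ D) (hX : X' ⊆ X) : StateSim D' X' s s' := by
  refine ⟨fun x hx => h.1 x (hX hx), fun i => ⟨fun x hx => ?_, fun x hx y hy => ?_⟩⟩
  · have := (h.2 i).1 x (hX hx)
    omega
  · have := (h.2 i).2 x (hX hx) y (hX hy)
    omega

theorem StateSim.symm {D : ℕ} {X : Finset ℕ} {s s' : ℕ → Q × (ι → ℕ)} (h : StateSim D X s s') :
    StateSim D X s' s :=
  ⟨fun x hx => (h.1 x hx).symm, fun i => ⟨fun x hx => ((h.2 i).1 x hx).symm,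
    fun x hx y hy => ((h.2 i).2 x hx y hy).symm⟩⟩

theorem StateSim.refl (D : ℕ) (X : Finset ℕ) (s : ℕ → Q × (ι → ℕ)) : StateSim D X s s :=
  ⟨fun _ _ => rfl, fun _ => ⟨fun _ _ => rfl, fun _ _ _ _ => rfl⟩⟩

theorem StateSim.extend {D : ℕ} {X : Finset ℕ} {s s' : ℕ → Q × (ι → ℕ)}
    (h : StateSim (2 * D) X s s') {x : ℕ} (hx : x ∉ X) (v : Q × (ι → ℕ)) :
    ∃ v' : Q × (ι → ℕ), StateSim D (insert x X) (update s x v) (update s' x v') ∧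
      ∀ i, v'.2 i ≤ D ∨ ∃ y ∈ X, v'.2 i ≤ (s' y).2 i + D := by
  choose c hb hc hX using fun i => (h.2 i).extend (v.2 i)
  have h' := h.mono (D' := D) (by omega) (Finset.Subset.refl X)
  have hne {y : ℕ} (hy : y ∈ X) : y ≠ x := fun h => hx (h ▸ hy)
  refine ⟨(v.1, c), ⟨fun y hy => ?_, fun i => ⟨fun y hy => ?_, fun y hy z hz => ?_⟩⟩, hb⟩
  · rcases Finset.mem_insert.1 hy with rfl | hy
    · simp
    · simpa [hne hy] using h'.1 y hy
  · rcases Finset.mem_insert.1 hy with rfl | hy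
    · simpa using hc i
    · simpa [hne hy] using (h'.2 i).1 y hy
  · rcases Finset.mem_insert.1 hy with rfl | hy' <;> rcases Finset.mem_insert.1 hz with rfl | hz'
    · simp
    · simpa [hne hz'] using (hX i z hz').1
    · simpa [hne hy'] using (hX i y hy').2
    · simpa [hne hy', hne hz'] using (h'.2 i).2 y hy' z hz'

theorem IsCoordinatewise.of_stateSim {R : Q × (ι → ℕ) → Q × (ι → ℕ) → Prop}
    (hR : IsCoordinatewise R) {D x y : ℕ} {s s' : ℕ → Q × (ι → ℕ)} (hD : 2 ≤ D)
    (h : StateSim D {x, y} s s') (hs : R (s x) (s y)) : R (s' x) (s' y) := by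
  obtain ⟨A, r, hr, hAr⟩ := hR
  have h' := h.mono hD (Finset.Subset.refl _)
  have hx : x ∈ ({x, y} : Finset ℕ) := by simp
  have hy : y ∈ ({x, y} : Finset ℕ) := by simp
  rw [hAr] at hs ⊢
  refine ⟨by rw [← h'.1 x hx, ← h'.1 y hy]; exact hs.1, fun i => ?_⟩
  exact hr i _ _ _ _ ((h'.2 i).1 x hx) ((h'.2 i).1 y hy) ((h'.2 i).2 x hx y hy)
    ((h'.2 i).2 y hy x hx) (hs.2 i)

/-- The quantifier rank of a formula. -/
def FORFormula.rank : FORFormula L → ℕ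
  | .eq _ _ => 0
  | .edge _ _ _ => 0
  | .reach _ _ _ => 0
  | .neg φ => φ.rank
  | .and φ ψ => max φ.rank ψ.rank
  | .ex _ φ => φ.rank + 1

/-- The evaluator sees only the code of a formula, so its search bound uses the code in place of the
rank. -/
theorem FORFormula.rank_le_code [Encodable L] (φ : FORFormula L) : φ.rank ≤ φ.code := by
  induction φ with
  | eq x y => exact Nat.zero_le _
  | edge a x y => exact Nat.zero_le _
  | reach S x y => exact Nat.zero_le _
  | neg φ ih => exact ih.trans (Nat.right_le_pair _ _)
  | and φ ψ ih₁ ih₂ =>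
    refine max_le (ih₁.trans ?_) (ih₂.trans ?_)
    · exact (Nat.left_le_pair _ _).trans (Nat.right_le_pair _ _)
    · exact (Nat.right_le_pair _ _).trans (Nat.right_le_pair _ _)
  | ex x φ ih =>
    have := Nat.add_le_pair 5 (Nat.pair x φ.code)
    have := Nat.right_le_pair x φ.code
    simp only [rank, code]
    omega

variable {G : LGraph L (Q × (ι → ℕ))}

/-- The threshold is 2 at rank 0, which is what truncated atoms require, and every quantifier costs
a factor of 2. -/
theorem LGraph.sat_of_stateSim (hedge : ∀ a, IsCoordinatewise (G.edge a))
    (hreach : ∀ S, IsCoordinatewise (G.Reach S)) (φ : FORFormula L) {s s' : ℕ → Q × (ι → ℕ)}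
    (h : StateSim (2 ^ (φ.rank + 1)) φ.freeVars s s') : G.Sat φ s ↔ G.Sat φ s' := by
  induction φ generalizing s s' with
  | eq x y =>
    exact ⟨isCoordinatewise_eq.of_stateSim le_rfl h, isCoordinatewise_eq.of_stateSim le_rfl h.symm⟩
  | edge a x y => exact ⟨(hedge a).of_stateSim le_rfl h, (hedge a).of_stateSim le_rfl h.symm⟩
  | reach S x y => exact ⟨(hreach S).of_stateSim le_rfl h, (hreach S).of_stateSim le_rfl h.symm⟩
  | neg φ ih => exact not_congr (ih h)
  | and φ ψ ih₁ ih₂ =>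
    refine and_congr (ih₁ (h.mono ?_ Finset.subset_union_left))
      (ih₂ (h.mono ?_ Finset.subset_union_right)) <;>
      refine Nat.pow_le_pow_right (by simp) ?_ <;> simp [FORFormula.rank]
  | ex x φ ih =>
    have key {s s' : ℕ → Q × (ι → ℕ)}
        (h : StateSim (2 ^ (φ.rank + 1 + 1)) (φ.freeVars.erase x) s s')
        (hs : G.Sat (.ex x φ) s) : G.Sat (.ex x φ) s' := by
      obtain ⟨v, hv⟩ := hs
      rw [pow_succ, mul_comm] at h
      obtain ⟨v', hv', -⟩ := h.extend (Finset.notMem_erase x _) v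
      exact ⟨v', (ih (hv'.mono le_rfl (Finset.insert_erase_subset x _))).1 hv⟩
    exact ⟨key h, key h.symm⟩

/-! ### Numbering the states with counters, and decidability by bounded search. -/

/-- The `i`-th component of an iterated pair. -/
def pairComponent (i m : ℕ) : ℕ := ((fun m => m.unpair.2)^[i] m).unpair.1

theorem pairComponent_le (i m : ℕ) : pairComponent i m ≤ m := by
  refine (Nat.unpair_left_le _).trans ?_
  induction i generalizing m with
  | zero => rfl
  | succ i ih => exact (ih _).trans (Nat.unpair_right_le m)

theorem primrec_pairComponent (i : ℕ) : Primrec (pairComponent i) :=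
  Primrec.fst.comp (Primrec.unpair.comp (Primrec.nat_iterate (Primrec.const i) .id
    (Primrec.snd.comp (Primrec.unpair.comp .snd))))

/-- A bound for the iterated pairs with `N` components at most `B`. -/
def pairBound (B : ℕ) : ℕ → ℕ
  | 0 => 0
  | N + 1 => Nat.pair B (pairBound B N)

theorem pair_le_pair {a b c d : ℕ} (h : a ≤ c) (h' : b ≤ d) : Nat.pair a b ≤ Nat.pair c d := by
  rcases h.lt_or_eq with h | rfl <;> rcases h'.lt_or_eq with h' | rfl
  · exact ((Nat.pair_lt_pair_left b h).trans (Nat.pair_lt_pair_right c h')).le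
  · exact (Nat.pair_lt_pair_left b h).le
  · exact (Nat.pair_lt_pair_right a h').le
  · rfl

theorem exists_pairComponent_eq {N : ℕ} (c : Fin N → ℕ) {B : ℕ} (hc : ∀ i, c i ≤ B) :
    ∃ m ≤ pairBound B N, ∀ i : Fin N, pairComponent i m = c i := by
  induction N with
  | zero => exact ⟨0, le_rfl, fun i => i.elim0⟩
  | succ N ih =>
    obtain ⟨m, hm, hcm⟩ := ih (fun i => c i.succ) fun i => hc _
    refine ⟨Nat.pair (c 0) m, pair_le_pair (hc 0) hm, fun i => ?_⟩
    refine Fin.cases ?_ (fun i => ?_) i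
    · simp [pairComponent]
    · rw [← hcm i]
      simp [pairComponent]

theorem primrec_pairBound (N : ℕ) : Primrec fun B => pairBound B N := by
  induction N with
  | zero => exact Primrec.const 0
  | succ N ih => exact Primrec₂.natPair.comp .id ih

/-- A bound for the codes in a list of bindings. -/
def bindingSum (env : List (ℕ × ℕ)) : ℕ := env.foldr (fun p n => p.2 + n) 0

theorem le_bindingSum {env : List (ℕ × ℕ)} {x e : ℕ} (h : env.lookup x = some e) :
    e ≤ bindingSum env := by
  induction env with
  | nil => simp at h
  | cons p env ih =>
    obtain ⟨y, e'⟩ := p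
    rw [List.lookup_cons] at h
    simp only [bindingSum, List.foldr_cons]
    split at h
    · have := Option.some.inj h
      omega
    · exact (ih h).trans (Nat.le_add_left _ _)

theorem primrec_bindingSum : Primrec bindingSum :=
  Primrec.list_foldr (h := fun _ (q : (ℕ × ℕ) × ℕ) => q.1.2 + q.2) .id (Primrec.const 0)
    (Primrec.nat_add.comp (Primrec.snd.comp (Primrec.fst.comp .snd)) (Primrec.snd.comp .snd))

theorem primrec_two_pow : Primrec fun n : ℕ => 2 ^ n :=
  (Primrec.nat_rec₁ 1 (f := fun _ m => 2 * m) (Primrec.nat_double.comp .snd)).of_eq fun n => by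
    induction n with
    | zero => rfl
    | succ n ih => exact (congrArg (2 * ·) ih).trans (pow_succ' 2 n).symm

/-- Any witness `v` can be replaced by a similar one whose counters exceed those already bound by at
most the threshold of the game, or are themselves at most that threshold. -/
theorem LGraph.hasDecidableFOR_of_isCoordinatewise {N : ℕ} [Finite Q] [Nonempty Q] [Finite L]
    [Encodable L] {G : LGraph L (Q × (Fin N → ℕ))} (hedge : ∀ a, IsCoordinatewise (G.edge a))
    (hreach : ∀ S, IsCoordinatewise (G.Reach S)) : G.HasDecidableFOR := by
  have : NeZero (Nat.card Q) := ⟨Nat.card_pos.ne'⟩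
  let eQ := Finite.equivFin Q
  let dec (e : ℕ) : Q × (Fin N → ℕ) :=
    (eQ.symm (Fin.ofNat _ e.unpair.1), fun i => pairComponent i e.unpair.2)
  have hprim {R : Q × (Fin N → ℕ) → Q × (Fin N → ℕ) → Prop} (hR : IsCoordinatewise R) :
      PrimrecRel fun e e' => R (dec e) (dec e') := by
    obtain ⟨A, r, hr, hAr⟩ := hR
    refine PrimrecRel.of_eq ?_ fun e e' => (hAr _ _).symm
    have h₁ : Primrec fun e : ℕ => e.unpair.1 := Primrec.fst.comp Primrec.unpair
    have h₂ : Primrec fun e : ℕ => e.unpair.2 := Primrec.snd.comp Primrec.unpair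
    refine PrimrecPred.and ?_ (PrimrecPred.forall_finite fun i => ?_)
    · exact (primrecRel_of_finite fun u v => A (eQ.symm u) (eQ.symm v)).comp
        (h₁.comp .fst) (h₁.comp .snd)
    · exact (hr i).primrecRel.comp (((primrec_pairComponent i).comp h₂).comp .fst)
        (((primrec_pairComponent i).comp h₂).comp .snd)
  refine G.hasDecidableFOR_of_bounded_witnesses dec (hprim isCoordinatewise_eq)
    (fun a => hprim (hedge a)) (fun S => hprim (hreach S))
    -- Pairing is monotone, so bounds for the index of the state and for each counter give a bound
    -- for the code of the vertex.
    (K := fun b => Nat.pair (Nat.card Q) (pairBound (bindingSum b.2 + 2 ^ (b.1 + 1)) N)) ?_ ?_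
  · refine Primrec₂.natPair.comp (Primrec.const _) ((primrec_pairBound N).comp ?_)
    exact Primrec.nat_add.comp (primrec_bindingSum.comp .snd)
      (primrec_two_pow.comp (Primrec.succ.comp .fst))
  · intro φ x env hfree v hv
    -- The game is played between the assignment and itself; only the new vertex differs.
    obtain ⟨v', hsim, hb⟩ := (StateSim.refl (2 * 2 ^ (φ.rank + 1)) (φ.freeVars.erase x)
      (assignment dec env)).extend (Finset.notMem_erase x _) v
    have hD : 2 ^ (φ.rank + 1) ≤ 2 ^ ((FORFormula.ex x φ).code + 1) := by
      refine Nat.pow_le_pow_right (by simp) (Nat.succ_le_succ ?_)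
      exact φ.rank.le_succ.trans (FORFormula.rank_le_code (.ex x φ))
    have hle (i : Fin N) :
        v'.2 i ≤ bindingSum env + 2 ^ ((FORFormula.ex x φ).code + 1) := by
      rcases hb i with h | ⟨y, hy, h⟩
      · omega
      · have hy' : y ∈ boundVars env := by
          have := hfree (Finset.mem_of_mem_erase hy)
          exact (Finset.mem_insert.1 this).resolve_left (Finset.ne_of_mem_erase hy)
        obtain ⟨e, he⟩ := mem_boundVars.1 hy'
        have h₁ : (assignment dec env y).2 i ≤ e := by
          simp only [assignment, he, Option.getD_some]
          exact (pairComponent_le _ _).trans (Nat.unpair_right_le e)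
        have h₂ := le_bindingSum he
        omega
    obtain ⟨m, hm, hcm⟩ := exists_pairComponent_eq v'.2 hle
    refine ⟨Nat.pair (eQ v'.1) m, pair_le_pair (eQ v'.1).2.le hm, ?_⟩
    have hdec : dec (Nat.pair (eQ v'.1) m) = v' := by
      refine Prod.ext ?_ (funext fun i => ?_)
      · simp [dec]
      · simpa [dec] using hcm i
    rw [hdec]
    exact (G.sat_of_stateSim hedge hreach φ
      (hsim.mono le_rfl (Finset.insert_erase_subset x _))).1 hv

end StateSim

theorem counterGraph_hasDecidableFOR {Q τ : Type} {N : ℕ} [Finite Q] [Nonempty Q] [Finite τ]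
    [Encodable (τ ⊕ τ)] (T : τ → Q × CounterOp (Fin N) × Q) : (counterGraph T).HasDecidableFOR :=
  LGraph.hasDecidableFOR_of_isCoordinatewise (isCoordinatewise_edge T)
    fun S => isCoordinatewise_reach S

/-! ### Generating the counter graph by ground tree rewriting. -/

/-- The symbols of the trees encoding a state together with `N` counters. -/
inductive TreeSymbol (Q : Type) (N : ℕ) : Type
  | root
  | state (q : Q)
  | base
  | succ
  | leaf (i : Fin N)

namespace TreeSymbol

variable {Q : Type} {N : ℕ}

/-- The ranks of the symbols. -/
abbrev arity : TreeSymbol Q N → ℕ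
  | root => N + 1
  | state _ => 0
  | base => 1
  | succ => 1
  | leaf _ => 0

instance [Finite Q] : Finite (TreeSymbol Q N) := by
  let f : TreeSymbol Q N → Fin 3 ⊕ Q ⊕ Fin N
    | root => .inl 0
    | state q => .inr (.inl q)
    | base => .inl 1
    | succ => .inl 2
    | leaf i => .inr (.inr i)
  refine Finite.of_injective f fun a b h => ?_
  cases a <;> cases b <;> simp_all [f]

end TreeSymbol

section Rewrite

variable {A : Type} {ar : A → ℕ}

theorem rewrite_mk_iff {l r : RankedTree ar} {a : A} {f : Fin (ar a) → RankedTree ar}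
    {s : RankedTree ar} : Rewrite l r (WType.mk (β := fun a => Fin (ar a)) a f) s ↔
      (WType.mk a f = l ∧ s = r) ∨
        ∃ i t, Rewrite l r (f i) t ∧ s = WType.mk (β := fun a => Fin (ar a)) a (update f i t) := by
  constructor
  · intro h
    generalize hu : WType.mk (β := fun a => Fin (ar a)) a f = u at h
    cases h with
    | root => exact .inl ⟨rfl, rfl⟩
    | child b g i t h =>
      cases hu
      exact .inr ⟨i, t, h, rfl⟩
  · rintro (⟨rfl, rfl⟩ | ⟨i, t, h, rfl⟩)
    · exact .root
    · exact .child a f i t h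

end Rewrite

namespace CounterTree

open TreeSymbol

variable {Q : Type} {N : ℕ}

/-- The tree which consists of a state. -/
def ofState (q : Q) : RankedTree (arity (Q := Q) (N := N)) := WType.mk (.state q) Fin.elim0

/-- The unary tree for the number `n` above the leaf of the counter `i`. -/
def chain (Q : Type) (i : Fin N) : ℕ → RankedTree (arity (Q := Q) (N := N))
  | 0 => WType.mk (.leaf i) Fin.elim0
  | n + 1 => WType.mk .succ fun _ => chain Q i n

/-- The tree for the counter `i` with value `n`. -/
def ofCounter (Q : Type) (i : Fin N) (n : ℕ) : RankedTree (arity (Q := Q) (N := N)) :=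
  WType.mk .base fun _ => chain Q i n

/-- The tree for a state together with the values of the counters. -/
def ofConfig (u : Q × (Fin N → ℕ)) : RankedTree (arity (Q := Q) (N := N)) :=
  WType.mk .root (Fin.cons (α := fun _ => RankedTree (arity (Q := Q) (N := N))) (ofState u.1)
    fun i => ofCounter Q i (u.2 i))

/-- The symbol at the root of a tree. -/
def top (t : RankedTree (arity (Q := Q) (N := N))) : TreeSymbol Q N :=
  match t with
  | WType.mk a _ => a


theorem ne_of_top_ne {s t : RankedTree (arity (Q := Q) (N := N))} (h : top s ≠ top t) : s ≠ t :=
  fun h' => h (congrArg top h')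

@[simp] theorem top_ofState (q : Q) : top (ofState (N := N) q) = .state q := rfl
@[simp] theorem top_chain_zero (i : Fin N) : top (chain Q i 0) = .leaf i := rfl
@[simp] theorem top_chain_succ (i : Fin N) (n : ℕ) : top (chain Q i (n + 1)) = .succ := rfl
@[simp] theorem top_ofCounter (i : Fin N) (n : ℕ) : top (ofCounter Q i n) = .base := rfl
@[simp] theorem top_ofConfig (u : Q × (Fin N → ℕ)) : top (ofConfig u) = .root := rfl

theorem ofState_inj {q q' : Q} : ofState (N := N) q = ofState q' ↔ q = q' := by
  refine ⟨fun h => ?_, fun h => h ▸ rfl⟩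
  simpa using congrArg top h

theorem chain_inj {i j : Fin N} {n m : ℕ} : chain Q i n = chain Q j m ↔ i = j ∧ n = m := by
  refine ⟨fun h => ?_, fun ⟨h, h'⟩ => h ▸ h' ▸ rfl⟩
  induction n generalizing m with
  | zero =>
    cases m with
    | zero => exact ⟨by simpa only [top_chain_zero, leaf.injEq] using congrArg top h, rfl⟩
    | succ m => exact absurd h (ne_of_top_ne (by simp))
  | succ n ih =>
    cases m with
    | zero =>
      exact absurd h (ne_of_top_ne (by simp))
    | succ m =>
      simp only [chain, WType.mk.injEq, heq_eq_eq, true_and] at h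
      have := ih (congrFun h (0 : Fin 1))
      omega

theorem ofCounter_inj {i j : Fin N} {n m : ℕ} :
    ofCounter Q i n = ofCounter Q j m ↔ i = j ∧ n = m := by
  refine ⟨fun h => ?_, fun ⟨h, h'⟩ => h ▸ h' ▸ rfl⟩
  simp only [ofCounter, WType.mk.injEq, heq_eq_eq, true_and] at h
  exact chain_inj.1 (congrFun h (0 : Fin 1))

theorem ofConfig_injective : Injective (ofConfig (Q := Q) (N := N)) := by
  intro u v h
  have h := eq_of_heq (WType.mk.inj h).2
  refine Prod.ext ?_ (funext fun i => ?_)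
  · exact ofState_inj.1 (congrFun h (0 : Fin (N + 1)))
  · exact (ofCounter_inj.1 (congrFun h (Fin.succ i : Fin (N + 1)))).2

theorem rewrite_ofState_iff {l r s : RankedTree (arity (Q := Q) (N := N))} {q : Q} :
    Rewrite l r (ofState q) s ↔ ofState q = l ∧ s = r := by
  refine (rewrite_mk_iff (ar := arity) (a := .state q)).trans ?_
  exact or_iff_left fun ⟨i, _⟩ => i.elim0

theorem rewrite_chain_zero_iff {l r s : RankedTree (arity (Q := Q) (N := N))} {j : Fin N} :
    Rewrite l r (chain Q j 0) s ↔ chain Q j 0 = l ∧ s = r := by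
  refine (rewrite_mk_iff (ar := arity) (a := .leaf j)).trans ?_
  exact or_iff_left fun ⟨i, _⟩ => i.elim0

theorem rewrite_chain_succ_iff {l r s : RankedTree (arity (Q := Q) (N := N))} {j : Fin N} {n : ℕ} :
    Rewrite l r (chain Q j (n + 1)) s ↔ (chain Q j (n + 1) = l ∧ s = r) ∨
      ∃ t, Rewrite l r (chain Q j n) t ∧ s = WType.mk .succ fun _ => t := by
  refine (rewrite_mk_iff (ar := arity) (a := .succ)).trans ?_
  refine or_congr_right ⟨fun ⟨i, t, h, hs⟩ => ⟨t, h, ?_⟩, fun ⟨t, h, hs⟩ => ⟨(0 : Fin 1), t, h, ?_⟩⟩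
  · rw [hs]
    congr 1
    funext k
    exact (update_apply (α := Fin 1) _ i t k).trans (if_pos (Subsingleton.elim k i))
  · rw [hs]
    congr 1
    funext k
    exact ((update_apply (α := Fin 1) _ 0 t k).trans (if_pos (Subsingleton.elim k 0))).symm

theorem rewrite_ofCounter_iff {l r s : RankedTree (arity (Q := Q) (N := N))} {j : Fin N} {n : ℕ} :
    Rewrite l r (ofCounter Q j n) s ↔ (ofCounter Q j n = l ∧ s = r) ∨
      ∃ t, Rewrite l r (chain Q j n) t ∧ s = WType.mk .base fun _ => t := by
  refine (rewrite_mk_iff (ar := arity) (a := .base)).trans ?_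
  refine or_congr_right ⟨fun ⟨i, t, h, hs⟩ => ⟨t, h, ?_⟩, fun ⟨t, h, hs⟩ => ⟨(0 : Fin 1), t, h, ?_⟩⟩
  · rw [hs]
    congr 1
    funext k
    exact (update_apply (α := Fin 1) _ i t k).trans (if_pos (Subsingleton.elim k i))
  · rw [hs]
    congr 1
    funext k
    exact ((update_apply (α := Fin 1) _ 0 t k).trans (if_pos (Subsingleton.elim k 0))).symm

/-- Keeps the rules for states and for zero tests from applying inside a counter. -/
theorem not_rewrite_chain {l r s : RankedTree (arity (Q := Q) (N := N))} {j : Fin N} {n : ℕ}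
    (hleaf : ∀ i, top l ≠ .leaf i) (hsucc : top l ≠ .succ) : ¬ Rewrite l r (chain Q j n) s := by
  induction n generalizing s with
  | zero =>
    rw [rewrite_chain_zero_iff]
    exact fun h => hleaf j (by rw [← h.1]; rfl)
  | succ n ih =>
    rw [rewrite_chain_succ_iff]
    rintro (h | ⟨t, h, -⟩)
    · exact hsucc (by rw [← h.1]; rfl)
    · exact ih h

/-- The left-hand side is a single leaf, so the number grows at the bottom of the chain, and the tag
of the leaf selects the counter. -/
theorem rewrite_chain_inc_iff {s : RankedTree (arity (Q := Q) (N := N))} {i j : Fin N} {n : ℕ} :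
    Rewrite (chain Q i 0) (chain Q i 1) (chain Q j n) s ↔ j = i ∧ s = chain Q j (n + 1) := by
  induction n generalizing s with
  | zero =>
    rw [rewrite_chain_zero_iff, chain_inj]
    constructor
    · rintro ⟨⟨rfl, -⟩, rfl⟩
      exact ⟨rfl, rfl⟩
    · rintro ⟨rfl, rfl⟩
      exact ⟨⟨rfl, rfl⟩, rfl⟩
  | succ n ih =>
    rw [rewrite_chain_succ_iff, chain_inj]
    simp only [ih]
    constructor
    · rintro (⟨⟨-, h⟩, -⟩ | ⟨t, ⟨rfl, rfl⟩, rfl⟩)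
      · omega
      · exact ⟨rfl, rfl⟩
    · rintro ⟨rfl, rfl⟩
      exact .inr ⟨_, ⟨rfl, rfl⟩, rfl⟩

theorem rewrite_chain_dec_iff {s : RankedTree (arity (Q := Q) (N := N))} {i j : Fin N} {n : ℕ} :
    Rewrite (chain Q i 1) (chain Q i 0) (chain Q j n) s ↔
      j = i ∧ n ≠ 0 ∧ s = chain Q j (n - 1) := by
  induction n generalizing s with
  | zero => simp [rewrite_chain_zero_iff, chain_inj]
  | succ n ih =>
    rw [rewrite_chain_succ_iff, chain_inj]
    simp only [ih]
    constructor
    · rintro (⟨⟨rfl, h⟩, rfl⟩ | ⟨t, ⟨rfl, h, rfl⟩, rfl⟩)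
      · simp_all
      · refine ⟨rfl, n.succ_ne_zero, ?_⟩
        obtain ⟨m, rfl⟩ := Nat.exists_eq_succ_of_ne_zero h
        rfl
    · rintro ⟨rfl, -, rfl⟩
      cases n with
      | zero => exact .inl ⟨⟨rfl, rfl⟩, rfl⟩
      | succ n => exact .inr ⟨_, ⟨rfl, n.succ_ne_zero, rfl⟩, rfl⟩

theorem rewrite_ofConfig_iff {l r s : RankedTree (arity (Q := Q) (N := N))} (hl : top l ≠ .root)
    {q : Q} {c : Fin N → ℕ} : Rewrite l r (ofConfig (q, c)) s ↔
      (ofState q = l ∧ s = WType.mk .root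
        (Fin.cons (α := fun _ => RankedTree (arity (Q := Q) (N := N))) r
          fun i => ofCounter Q i (c i))) ∨
      ∃ i t, Rewrite l r (ofCounter Q i (c i)) t ∧ s = WType.mk .root
        (Fin.cons (α := fun _ => RankedTree (arity (Q := Q) (N := N))) (ofState q)
          (update (fun i => ofCounter Q i (c i)) i t)) := by
  refine (rewrite_mk_iff (ar := arity) (a := .root)).trans ?_
  rw [or_iff_right (fun h => hl (by rw [← h.1]; rfl))]
  constructor
  · rintro ⟨k, t, h, rfl⟩
    change Fin (N + 1) at k
    revert h
    refine Fin.cases (fun h => .inl ?_) (fun i h => .inr ⟨i, t, h, ?_⟩) k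
    · obtain ⟨hq, rfl⟩ := rewrite_ofState_iff.1 h
      exact ⟨hq, congrArg (WType.mk TreeSymbol.root) (Fin.update_cons_zero (n := N) _ _ _)⟩
    · exact congrArg (WType.mk TreeSymbol.root) (Fin.cons_update (n := N) _ _ _ _).symm
  · rintro (⟨h, rfl⟩ | ⟨i, t, h, rfl⟩)
    · exact ⟨(0 : Fin (N + 1)), r, rewrite_ofState_iff.2 ⟨h, rfl⟩,
        congrArg (WType.mk TreeSymbol.root) (Fin.update_cons_zero (n := N) _ _ _).symm⟩
    · exact ⟨(i.succ : Fin (N + 1)), t, h,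
        congrArg (WType.mk TreeSymbol.root) (Fin.cons_update (n := N) _ _ _ _)⟩

theorem rewrite_state_iff {q p p' : Q} {c : Fin N → ℕ}
    {s : RankedTree (arity (Q := Q) (N := N))} :
    Rewrite (ofState p) (ofState p') (ofConfig (q, c)) s ↔ q = p ∧ s = ofConfig (p', c) := by
  rw [rewrite_ofConfig_iff (by simp), ofState_inj]
  refine or_iff_left ?_
  rintro ⟨i, t, h, -⟩
  rw [rewrite_ofCounter_iff] at h
  rcases h with ⟨h, -⟩ | ⟨t, h, -⟩
  · exact ne_of_top_ne (by simp) h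
  · exact not_rewrite_chain (by simp) (by simp) h

theorem ofConfig_update (q : Q) (c : Fin N → ℕ) (i : Fin N) (n : ℕ) :
    ofConfig (q, update c i n) = WType.mk .root
      (Fin.cons (α := fun _ => RankedTree (arity (Q := Q) (N := N))) (ofState q)
        (update (fun i => ofCounter Q i (c i)) i (ofCounter Q i n))) := by
  have : (fun j => ofCounter Q j (update c i n j)) =
      update (fun j => ofCounter Q j (c j)) i (ofCounter Q i n) := by
    funext j
    rcases eq_or_ne j i with rfl | h <;> simp [*]
  rw [← this]
  rfl

/-- The rules which perform an operation on the counters. -/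
def opRules : CounterOp (Fin N) →
    Set (RankedTree (arity (Q := Q) (N := N)) × RankedTree (arity (Q := Q) (N := N)))
  | .nop => Set.range fun q => (ofState q, ofState q)
  | .inc i => {(chain Q i 0, chain Q i 1)}
  | .dec i => {(chain Q i 1, chain Q i 0)}
  | .zero i => {(ofCounter Q i 0, ofCounter Q i 0)}
  | .stuck => ∅

/-- Every rule has at most one place to apply. Leaves carry the index of their counter, so
increments and decrements act at the bottom of the right chain. The symbol `base` stands directly
above the leaf only if the counter is zero, which makes the zero test a ground rule. For `nop` the
one state present is replaced by itself. -/
theorem rewrite_opRules_iff {op : CounterOp (Fin N)} {q : Q} {c : Fin N → ℕ}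
    {s : RankedTree (arity (Q := Q) (N := N))} :
    (∃ p ∈ opRules op, Rewrite p.1 p.2 (ofConfig (q, c)) s) ↔
      ∃ c', op.Rel c c' ∧ s = ofConfig (q, c') := by
  cases op with
  | nop =>
    simp only [opRules, Set.exists_range_iff, rewrite_state_iff, CounterOp.Rel]
    constructor
    · rintro ⟨p, rfl, h⟩
      exact ⟨c, rfl, h⟩
    · rintro ⟨_, rfl, h⟩
      exact ⟨q, rfl, h⟩
  | inc i =>
    simp only [opRules, Set.mem_singleton_iff, exists_eq_left, CounterOp.Rel]
    rw [rewrite_ofConfig_iff (by simp), or_iff_right (fun h => ne_of_top_ne (by simp) h.1),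
      ofConfig_update]
    constructor
    · rintro ⟨j, t, h, rfl⟩
      rw [rewrite_ofCounter_iff, or_iff_right (fun h => ne_of_top_ne (by simp) h.1)] at h
      obtain ⟨t, h, rfl⟩ := h
      obtain ⟨rfl, rfl⟩ := rewrite_chain_inc_iff.1 h
      rfl
    · intro h
      refine ⟨i, _, rewrite_ofCounter_iff.2 (.inr ⟨_, rewrite_chain_inc_iff.2 ⟨rfl, rfl⟩, rfl⟩), h⟩
  | dec i =>
    simp only [opRules, Set.mem_singleton_iff, exists_eq_left, CounterOp.Rel, and_assoc,
      exists_and_left]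
    rw [rewrite_ofConfig_iff (by simp), or_iff_right (fun h => ne_of_top_ne (by simp) h.1),
      ofConfig_update]
    constructor
    · rintro ⟨j, t, h, rfl⟩
      rw [rewrite_ofCounter_iff, or_iff_right (fun h => ne_of_top_ne (by simp) h.1)] at h
      obtain ⟨t, h, rfl⟩ := h
      obtain ⟨rfl, h', rfl⟩ := rewrite_chain_dec_iff.1 h
      exact ⟨h', rfl⟩
    · rintro ⟨h', h⟩
      exact ⟨i, _, rewrite_ofCounter_iff.2
        (.inr ⟨_, rewrite_chain_dec_iff.2 ⟨rfl, h', rfl⟩, rfl⟩), h⟩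
  | zero i =>
    simp only [opRules, Set.mem_singleton_iff, exists_eq_left, CounterOp.Rel, and_assoc,
      exists_and_left]
    rw [rewrite_ofConfig_iff (by simp), or_iff_right (fun h => ne_of_top_ne (by simp) h.1)]
    constructor
    · rintro ⟨j, t, h, rfl⟩
      rw [rewrite_ofCounter_iff, or_iff_left
        (fun ⟨t, h, _⟩ => not_rewrite_chain (by simp) (by simp) h), ofCounter_inj] at h
      obtain ⟨⟨rfl, h⟩, rfl⟩ := h
      refine ⟨h, ?_⟩
      rw [← ofConfig_update, ← h, update_eq_self]
    · rintro ⟨h, rfl⟩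
      refine ⟨i, ofCounter Q i 0, rewrite_ofCounter_iff.2 (.inl ⟨by rw [h], rfl⟩), ?_⟩
      rw [← ofConfig_update, ← h, update_eq_self]
  | stuck => simp [opRules, CounterOp.Rel]

theorem finite_opRules [Finite Q] (op : CounterOp (Fin N)) : (opRules (Q := Q) op).Finite := by
  cases op with
  | nop => exact Set.finite_range _
  | _ => simp [opRules]

/-- The ground tree rewriting system of a family of transitions. -/
def system [Finite Q] {τ : Type} [Finite τ] (T : τ → Q × CounterOp (Fin N) × Q) (q₀ : Q) :
    GTRS (arity (Q := Q) (N := N)) (τ ⊕ τ) where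
  rules := (Set.range fun j => (ofState (T j).1, .inl j, ofState (T j).2.2)) ∪
    ⋃ j, (fun p => (p.1, .inr j, p.2)) '' opRules (T j).2.1
  finite_rules := (Set.finite_range _).union
    (Set.finite_iUnion fun _ => (finite_opRules _).image _)
  init := ofConfig (q₀, 0)

variable [Finite Q] {τ : Type} [Finite τ] {T : τ → Q × CounterOp (Fin N) × Q} {q₀ : Q}

theorem step_ofConfig_iff {a : τ ⊕ τ} {u : Q × (Fin N → ℕ)}
    {s : RankedTree (arity (Q := Q) (N := N))} :
    (system T q₀).Step a (ofConfig u) s ↔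
      ∃ v, (counterGraph T).edge a u v ∧ s = ofConfig v := by
  obtain ⟨q, c⟩ := u
  cases a with
  | inl j =>
    have : (system T q₀).Step (.inl j) (ofConfig (q, c)) s ↔
        Rewrite (ofState (T j).1) (ofState (T j).2.2) (ofConfig (q, c)) s := by
      simp only [GTRS.Step, system, Set.mem_union, Set.mem_range, Set.mem_iUnion, Set.mem_image,
        Prod.mk.injEq, reduceCtorEq, false_and, and_false, exists_false, or_false,
        Sum.inl.injEq]
      constructor
      · rintro ⟨_, _, ⟨_, rfl, rfl, rfl⟩, h⟩
        exact h
      · exact fun h => ⟨_, _, ⟨j, rfl, rfl, rfl⟩, h⟩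
    rw [this, rewrite_state_iff]
    constructor
    · rintro ⟨h, rfl⟩
      exact ⟨(_, c), ⟨h, rfl, rfl⟩, rfl⟩
    · rintro ⟨⟨q', c'⟩, ⟨h₁, h₂, h₃⟩, rfl⟩
      dsimp only at h₁ h₂ h₃
      exact ⟨h₁, by rw [h₂, h₃]⟩
  | inr j =>
    have : (system T q₀).Step (.inr j) (ofConfig (q, c)) s ↔
        ∃ p ∈ opRules (T j).2.1, Rewrite p.1 p.2 (ofConfig (q, c)) s := by
      simp only [GTRS.Step, system, Set.mem_union, Set.mem_range, Set.mem_iUnion, Set.mem_image,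
        Prod.mk.injEq, reduceCtorEq, false_and, and_false, exists_false, false_or,
        Sum.inr.injEq]
      constructor
      · rintro ⟨_, _, ⟨_, p, hp, rfl, rfl, rfl⟩, h⟩
        exact ⟨p, hp, h⟩
      · exact fun ⟨p, hp, h⟩ => ⟨_, _, ⟨j, p, hp, rfl, rfl, rfl⟩, h⟩
    rw [this, rewrite_opRules_iff]
    constructor
    · rintro ⟨c', h, rfl⟩
      exact ⟨(q, c'), ⟨rfl, h⟩, rfl⟩
    · rintro ⟨⟨q', c'⟩, ⟨h₁, h₂⟩, rfl⟩
      dsimp only at h₁ h₂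
      exact ⟨c', h₂, by rw [h₁]⟩

/-- All configurations are generated: a state label leads from `q₀` to any state, and the increments
then fill the counters. The operation attached to the chosen state change is irrelevant, since in
this graph its label need not be used. -/
theorem reachable_iff (hstate : ∀ q, ∃ j, (T j).1 = q₀ ∧ (T j).2.2 = q)
    (hinc : ∀ i, ∃ j, (T j).2.1 = .inc i) (t : RankedTree (arity (Q := Q) (N := N))) :
    Relation.ReflTransGen (fun s s' => ∃ b, (system T q₀).Step b s s') (system T q₀).init t ↔
      ∃ u, ofConfig u = t := by
  constructor
  · intro h
    induction h with
    | refl => exact ⟨_, rfl⟩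
    | tail _ h ih =>
      obtain ⟨u, rfl⟩ := ih
      obtain ⟨a, h⟩ := h
      obtain ⟨v, -, rfl⟩ := step_ofConfig_iff.1 h
      exact ⟨v, rfl⟩
  · rintro ⟨⟨q, c⟩, rfl⟩
    have := Fintype.ofFinite τ
    have h : (counterGraph T).Reach Finset.univ (q₀, 0) (q, c) := by
      rw [counterGraph_reach_iff]
      obtain ⟨j, hj, hj'⟩ := hstate q
      refine ⟨.single ⟨j, Finset.mem_univ _, hj.symm, hj'.symm⟩, fun i => ⟨.inr ?_, .inl ?_⟩⟩
      · obtain ⟨j, hj⟩ := hinc i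
        exact ⟨j, Finset.mem_univ _, hj⟩
      · exact Nat.zero_le _
    exact Relation.ReflTransGen.lift
      (p := fun s s' => ∃ b, (system T q₀).Step b s s') ofConfig
      (fun u v ⟨a, _, h⟩ => ⟨a, step_ofConfig_iff.2 ⟨v, h, rfl⟩⟩) _ _ h

/-- The vertices generated by the system are the states with counters. -/
noncomputable def vertexEquiv (hstate : ∀ q, ∃ j, (T j).1 = q₀ ∧ (T j).2.2 = q)
    (hinc : ∀ i, ∃ j, (T j).2.1 = .inc i) : (system T q₀).Vertex ≃ Q × (Fin N → ℕ) :=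
  (Equiv.ofBijective
    (fun u => (⟨ofConfig u, (reachable_iff hstate hinc _).2 ⟨u, rfl⟩⟩ : (system T q₀).Vertex))
    ⟨fun _ _ h => ofConfig_injective (congrArg Subtype.val h), fun ⟨t, ht⟩ => by
      obtain ⟨u, hu⟩ := (reachable_iff hstate hinc t).1 ht
      exact ⟨u, Subtype.ext hu⟩⟩).symm

theorem edge_iff_vertexEquiv (hstate : ∀ q, ∃ j, (T j).1 = q₀ ∧ (T j).2.2 = q)
    (hinc : ∀ i, ∃ j, (T j).2.1 = .inc i) (a : τ ⊕ τ) (u v : (system T q₀).Vertex) :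
    (system T q₀).graph.edge a u v ↔
      (counterGraph T).edge a (vertexEquiv hstate hinc u) (vertexEquiv hstate hinc v) := by
  obtain ⟨u, rfl⟩ := (vertexEquiv hstate hinc).symm.surjective u
  obtain ⟨v, rfl⟩ := (vertexEquiv hstate hinc).symm.surjective v
  simp only [Equiv.apply_symm_apply]
  refine step_ofConfig_iff.trans ⟨?_, fun h => ⟨v, h, rfl⟩⟩
  rintro ⟨w, h, hw⟩
  exact (ofConfig_injective hw : v = w) ▸ h

end CounterTree

/-- Every label acts as a partial function, so an outgoing edge is determined by its label. -/
theorem counterGraph_finiteOutDegree {Q ι τ : Type} [DecidableEq ι] [Finite τ]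
    (T : τ → Q × CounterOp ι × Q) : (counterGraph T).FiniteOutDegree := by
  intro u
  refine Set.Finite.of_finite_image (f := Prod.fst) (Set.toFinite _) ?_
  rintro ⟨a, v⟩ hv ⟨b, w⟩ hw h
  obtain rfl : a = b := h
  refine Prod.ext rfl ?_
  cases a with
  | inl j => exact Prod.ext (hv.2.1.trans hw.2.1.symm) (hv.2.2.trans hw.2.2.symm)
  | inr j => exact Prod.ext (hv.1.trans hw.1.symm) (hv.2.unique hw.2)

theorem LGraph.finiteOutDegree_equiv {L V V' : Type} {G : LGraph L V} {H : LGraph L V'}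
    (e : V ≃ V') (he : ∀ a u v, G.edge a u v ↔ H.edge a (e u) (e v)) (h : H.FiniteOutDegree) :
    G.FiniteOutDegree := by
  intro u
  refine ((h (e u)).preimage (f := Prod.map id e)
    (Injective.prodMap injective_id e.injective).injOn).subset fun p hp => ?_
  exact (he p.1 u p.2).1 hp

/-! ### Loop programs as counter machines with finite control. -/

/-- Programs over counters: `loop r p` decrements `r` and executes `p` as long as `r` is not zero. -/
inductive CounterProg (ι : Type) : Type
  | skip
  | inc (r : ι)
  | seq (p q : CounterProg ι)
  | loop (r : ι) (p : CounterProg ι)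

namespace CounterProg

section Semantics

variable {ι : Type}

/-- The transitions between residuals of programs that remain to be executed. -/
inductive Trans : List (CounterProg ι) → CounterOp ι → List (CounterProg ι) → Prop
  | skip (K : List (CounterProg ι)) : Trans (.skip :: K) .nop K
  | inc (r : ι) (K : List (CounterProg ι)) : Trans (.inc r :: K) (.inc r) K
  | seq (p q : CounterProg ι) (K : List (CounterProg ι)) : Trans (.seq p q :: K) .nop (p :: q :: K)
  | loop_zero (r : ι) (p : CounterProg ι) (K : List (CounterProg ι)) :
      Trans (.loop r p :: K) (.zero r) K
  | loop_succ (r : ι) (p : CounterProg ι) (K : List (CounterProg ι)) :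
      Trans (.loop r p :: K) (.dec r) (p :: .loop r p :: K)

/-- The stacks that occur in the execution of `p` on top of the stack `K`. -/
def residuals : CounterProg ι → List (CounterProg ι) → Set (List (CounterProg ι))
  | .skip, K => {.skip :: K, K}
  | .inc r, K => {.inc r :: K, K}
  | .seq p q, K => insert (.seq p q :: K) (residuals p (q :: K) ∪ residuals q K)
  | .loop r p, K => insert (.loop r p :: K) (insert K (residuals p (.loop r p :: K)))

theorem finite_residuals (p : CounterProg ι) (K : List (CounterProg ι)) : (residuals p K).Finite := by
  induction p generalizing K with
  | skip => exact (Set.finite_singleton K).insert _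
  | inc r => exact (Set.finite_singleton K).insert _
  | seq p q ih₁ ih₂ => exact ((ih₁ _).union (ih₂ _)).insert _
  | loop r p ih => exact ((ih _).insert _).insert _

theorem cons_mem_residuals (p : CounterProg ι) (K : List (CounterProg ι)) : p :: K ∈ residuals p K := by
  cases p <;> simp [residuals]

theorem mem_residuals (p : CounterProg ι) (K : List (CounterProg ι)) : K ∈ residuals p K := by
  induction p generalizing K with
  | seq p q ih₁ ih₂ => exact .inr (.inr (ih₂ K))
  | _ => simp [residuals]

/-- Only `K` itself can lead out of the residuals. With `K` empty there is no such step, so the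
residuals form a finite set of control states. An entered loop is pushed back beneath its body and
is popped when it ends, which keeps the stacks bounded. -/
theorem Trans.mem_residuals {p : CounterProg ι} {K K₁ K₂ : List (CounterProg ι)} {op : CounterOp ι}
    (h : Trans K₁ op K₂) (h₁ : K₁ ∈ residuals p K) : K₂ ∈ residuals p K ∨ K₁ = K := by
  induction p generalizing K with
  | skip =>
    rcases h₁ with rfl | h₁
    · cases h
      exact .inl (.inr rfl)
    · exact .inr h₁
  | inc r =>
    rcases h₁ with rfl | h₁
    · cases h
      exact .inl (.inr rfl)
    · exact .inr h₁
  | seq p q ih₁ ih₂ =>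
    rcases h₁ with rfl | h₁ | h₁
    · cases h
      exact .inl (.inr (.inl (cons_mem_residuals _ _)))
    · rcases ih₁ h₁ with h' | rfl
      · exact .inl (.inr (.inl h'))
      · rcases ih₂ (cons_mem_residuals q K) with h' | h'
        · exact .inl (.inr (.inr h'))
        · simp at h'
    · rcases ih₂ h₁ with h' | h'
      · exact .inl (.inr (.inr h'))
      · exact .inr h'
  | loop r p ih =>
    rcases h₁ with rfl | rfl | h₁
    · cases h
      · exact .inl (.inr (.inl rfl))
      · exact .inl (.inr (.inr (cons_mem_residuals _ _)))
    · exact .inr rfl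
    · rcases ih h₁ with h' | rfl
      · exact .inl (.inr (.inr h'))
      · cases h
        · exact .inl (.inr (.inl rfl))
        · exact .inl (.inr (.inr (cons_mem_residuals _ _)))

variable [DecidableEq ι]

/-- Terminating executions of programs. -/
inductive Runs : CounterProg ι → (ι → ℕ) → (ι → ℕ) → Prop
  | skip (M : ι → ℕ) : Runs .skip M M
  | inc (r : ι) (M : ι → ℕ) : Runs (.inc r) M (update M r (M r + 1))
  | seq {p q : CounterProg ι} {M₁ M₂ M₃ : ι → ℕ} (h₁ : Runs p M₁ M₂) (h₂ : Runs q M₂ M₃) :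
      Runs (.seq p q) M₁ M₃
  | loop_zero (r : ι) (p : CounterProg ι) (M : ι → ℕ) (h : M r = 0) : Runs (.loop r p) M M
  | loop_succ {r : ι} {p : CounterProg ι} {M₁ M₂ M₃ : ι → ℕ} (h : M₁ r ≠ 0)
      (h₁ : Runs p (update M₁ r (M₁ r - 1)) M₂) (h₂ : Runs (.loop r p) M₂ M₃) :
      Runs (.loop r p) M₁ M₃

/-- One step of a stack of programs. -/
def Step (u v : List (CounterProg ι) × (ι → ℕ)) : Prop :=
  ∃ op, Trans u.1 op v.1 ∧ op.Rel u.2 v.2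

theorem step_of_trans {K K' : List (CounterProg ι)} {op : CounterOp ι} {M M' : ι → ℕ}
    (h : Trans K op K') (h' : op.Rel M M') : Step (K, M) (K', M') :=
  ⟨op, h, h'⟩

/-- A stack admits two transitions only if a loop is on top, and then the test for zero and the
decrement exclude each other. -/
theorem Step.unique {u v w : List (CounterProg ι) × (ι → ℕ)} (hv : Step u v) (hw : Step u w) :
    v = w := by
  obtain ⟨K, M⟩ := u
  obtain ⟨K₁, M₁⟩ := v
  obtain ⟨K₂, M₂⟩ := w
  obtain ⟨op₁, h₁, h₁'⟩ := hv
  obtain ⟨op₂, h₂, h₂'⟩ := hw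
  cases h₁ <;> cases h₂ <;> simp_all [CounterOp.Rel]

theorem not_step_nil {M : ι → ℕ} {v : List (CounterProg ι) × (ι → ℕ)} : ¬ Step ([], M) v := by
  rintro ⟨op, h, -⟩
  cases h

theorem Runs.steps {p : CounterProg ι} {M M' : ι → ℕ} (h : Runs p M M')
    (K : List (CounterProg ι)) : Relation.ReflTransGen Step (p :: K, M) (K, M') := by
  induction h generalizing K with
  | skip M => exact .single ⟨_, .skip K, rfl⟩
  | inc r M => exact .single ⟨_, .inc r K, rfl⟩
  | seq h₁ h₂ ih₁ ih₂ => exact .head (step_of_trans (.seq _ _ K) rfl) ((ih₁ _).trans (ih₂ K))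
  | loop_zero r p M h => exact .single ⟨_, .loop_zero r p K, h, rfl⟩
  | loop_succ h h₁ h₂ ih₁ ih₂ =>
    exact .head (step_of_trans (.loop_succ _ _ K) ⟨h, rfl⟩) ((ih₁ _).trans (ih₂ K))

/-- Execution of a loop with an invariant indexed by the remaining number of iterations. -/
theorem runs_loop {r : ι} {p : CounterProg ι} {I : ℕ → (ι → ℕ) → Prop}
    (hr : ∀ k M, I k M → M r = k)
    (hp : ∀ k M, I (k + 1) M → ∃ M', Runs p (update M r k) M' ∧ I k M') {k : ℕ} {M : ι → ℕ}
    (h : I k M) : ∃ M', Runs (.loop r p) M M' ∧ I 0 M' := by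
  induction k generalizing M with
  | zero => exact ⟨M, .loop_zero r p M (hr 0 M h), h⟩
  | succ k ih =>
    have hk := hr _ _ h
    obtain ⟨M₁, h₁, hI₁⟩ := hp k M h
    obtain ⟨M₂, h₂, hI₂⟩ := ih hI₁
    exact ⟨M₂, .loop_succ (by omega) (by rwa [hk]) h₂, hI₂⟩

/-- Setting a counter to zero. -/
def clear (r : ι) : CounterProg ι := .loop r .skip

theorem exists_runs_clear (r : ι) (M : ι → ℕ) :
    ∃ M', Runs (clear r) M M' ∧ M' r = 0 ∧ ∀ r' ≠ r, M' r' = M r' := by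
  obtain ⟨M', h, h'⟩ := runs_loop (r := r) (p := .skip)
    (I := fun k M' => M' r = k ∧ ∀ r' ≠ r, M' r' = M r') (fun _ _ h => h.1)
    (fun k M' h => ⟨_, .skip _, by simp, fun r' hr => by simp [hr, h.2]⟩)
    (k := M r) (M := M) ⟨rfl, fun _ _ => rfl⟩
  exact ⟨M', h, h'⟩

/-- Copying the counter `a` to the counter `b` by means of the auxiliary counter `t`. -/
def copy (a b t : ι) : CounterProg ι :=
  .seq (clear b) (.seq (clear t) (.seq (.loop a (.inc t)) (.loop t (.seq (.inc a) (.inc b)))))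

theorem exists_runs_copy {a b t : ι} (hab : a ≠ b) (hat : a ≠ t) (hbt : b ≠ t) (M : ι → ℕ) :
    ∃ M', Runs (copy a b t) M M' ∧ M' b = M a ∧ ∀ r, r ≠ b → r ≠ t → M' r = M r := by
  obtain ⟨M₁, h₁, hb₁, hM₁⟩ := exists_runs_clear b M
  obtain ⟨M₂, h₂, ht₂, hM₂⟩ := exists_runs_clear t M₁
  obtain ⟨M₃, h₃, ha₃, ht₃, hM₃⟩ := runs_loop (r := a) (p := .inc t)
    (I := fun k M' => M' a = k ∧ M' t + k = M a ∧ ∀ r, r ≠ a → r ≠ t → M' r = M₂ r)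
    (fun _ _ h => h.1)
    (fun k M' ⟨ha, ht, h⟩ => ⟨_, .inc t _, by simp [hat], by
      simp only [update_self, ne_eq, hat.symm, not_false_eq_true, update_of_ne]; omega,
      fun r hra hrt => by simp [hra, hrt, h]⟩)
    (k := M a) (M := M₂) ⟨by rw [hM₂ a hat, hM₁ a hab], by omega, fun _ _ _ => rfl⟩
  obtain ⟨M₄, h₄, ht₄, ha₄, hb₄, hM₄⟩ := runs_loop (r := t) (p := .seq (.inc a) (.inc b))
    (I := fun k M' => M' t = k ∧ M' a + k = M a ∧ M' b + k = M a ∧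
      ∀ r, r ≠ a → r ≠ b → r ≠ t → M' r = M₃ r)
    (fun _ _ h => h.1)
    (fun k M' ⟨ht, ha, hb, h⟩ => ⟨_, .seq (.inc a _) (.inc b _), by simp [hat.symm, hbt.symm], by
      simp [hat, hab]; omega, by simp [hab.symm, hbt]; omega,
      fun r hra hrb hrt => by simp [hra, hrb, hrt, h]⟩)
    (k := M a) (M := M₃) ⟨by omega, by omega, by
      rw [hM₃ b hab.symm hbt, hM₂ b hbt, hb₁]; omega, fun _ _ _ _ => rfl⟩
  refine ⟨M₄, .seq h₁ (.seq h₂ (.seq h₃ h₄)), by omega, fun r hrb hrt => ?_⟩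
  by_cases hra : r = a
  · subst hra
    omega
  · rw [hM₄ r hra hrb hrt, hM₃ r hra hrt, hM₂ r hrt, hM₁ r hrb]

end Semantics

/-! ### Primitive recursive functions, and unbounded search. -/

/-- A function is computable by programs if, for all choices of registers, some program computes
it and changes, among the registers below a given bound, only the output register. -/
def Computes {n : ℕ} (f : List.Vector ℕ n → ℕ) : Prop :=
  ∀ (ins : Fin n → ℕ) (out base : ℕ), (∀ i, ins i < base) → out < base → (∀ i, ins i ≠ out) →
    ∃ p : CounterProg ℕ, ∀ M, ∃ M', Runs p M M' ∧
      M' out = f (List.Vector.ofFn fun i => M (ins i)) ∧ ∀ r < base, r ≠ out → M' r = M r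

/-- The values of the `g i` are collected in the registers from `base` to `base + n - 1`. Each
subprogram is given the bound `base + n`, so its scratch registers lie above them. -/
theorem Computes.comp {m n : ℕ} {f : List.Vector ℕ n → ℕ} {g : Fin n → List.Vector ℕ m → ℕ}
    (hf : Computes f) (hg : ∀ i, Computes (g i)) :
    Computes fun v => f (List.Vector.ofFn fun i => g i v) := by
  intro ins out base hins hout hne
  have hprefix (k : ℕ) (hk : k ≤ n) : ∃ p : CounterProg ℕ, ∀ M, ∃ M', Runs p M M' ∧
      (∀ i : Fin n, (i : ℕ) < k →
        M' (base + i) = g i (List.Vector.ofFn fun i => M (ins i))) ∧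
      ∀ r < base, M' r = M r := by
    induction k with
    | zero => exact ⟨.skip, fun M => ⟨M, .skip M, by simp, fun _ _ => rfl⟩⟩
    | succ k ih =>
      obtain ⟨p, hp⟩ := ih (by omega)
      obtain ⟨q, hq⟩ := hg ⟨k, hk⟩ ins (base + k) (base + n) (fun i => by have := hins i; omega)
        (by omega) (fun i => by have := hins i; omega)
      refine ⟨.seq p q, fun M => ?_⟩
      obtain ⟨M₁, h₁, hval₁, hM₁⟩ := hp M
      obtain ⟨M₂, h₂, hval₂, hM₂⟩ := hq M₁
      refine ⟨M₂, .seq h₁ h₂, fun i hi => ?_, fun r hr => ?_⟩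
      · rcases Nat.lt_succ_iff_lt_or_eq.1 hi with hi' | hi'
        · rw [hM₂ _ (by omega) (by omega), hval₁ i hi']
        · obtain rfl : i = ⟨k, hk⟩ := Fin.ext hi'
          rw [hval₂]
          simp only [fun i => hM₁ _ (hins i)]
      · rw [hM₂ r (by omega) (by omega), hM₁ r hr]
  obtain ⟨p, hp⟩ := hprefix n le_rfl
  obtain ⟨q, hq⟩ := hf (fun i => base + i) out (base + n) (fun i => by omega) (by omega)
    (fun i => by omega)
  refine ⟨.seq p q, fun M => ?_⟩
  obtain ⟨M₁, h₁, hval₁, hM₁⟩ := hp M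
  obtain ⟨M₂, h₂, hval₂, hM₂⟩ := hq M₁
  refine ⟨M₂, .seq h₁ h₂, ?_, fun r hr hr' => ?_⟩
  · rw [hval₂]
    simp only [fun i : Fin n => hval₁ i i.2]
  · rw [hM₂ r (by omega) hr', hM₁ r hr]

/-- Register `base` counts down the remaining iterations, `base + 1` holds the current argument `y`,
`base + 2` the accumulated value, `base + 3` the output of `g`, and `base + 4` is scratch space for
copying. The loop invariant says that `base + 2` holds the recursion value at `y`. -/
theorem Computes.prec {n : ℕ} {f : List.Vector ℕ n → ℕ} {g : List.Vector ℕ (n + 2) → ℕ}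
    (hf : Computes f) (hg : Computes g) :
    Computes fun v : List.Vector ℕ (n + 1) =>
      v.head.rec (f v.tail) fun y IH => g (y ::ᵥ IH ::ᵥ v.tail) := by
  intro ins out base hins hout hne
  obtain ⟨p, hp⟩ := hf (fun i => ins i.succ) (base + 2) (base + 5)
    (fun i => by have := hins i.succ; omega) (by omega) (fun i => by have := hins i.succ; omega)
  obtain ⟨q, hq⟩ := hg
    (Fin.cons (base + 1) (Fin.cons (base + 2) fun i => ins i.succ) : Fin (n + 2) → ℕ)
    (base + 3) (base + 5)
    (fun i => by
      refine Fin.cases (by simp) (fun i => Fin.cases (by simp) (fun i => ?_) i) i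
      have := hins i.succ
      simp only [Fin.cons_succ]
      omega)
    (by omega)
    (fun i => by
      refine Fin.cases (by simp) (fun i => Fin.cases (by simp) (fun i => ?_) i) i
      have := hins i.succ
      simp only [Fin.cons_succ]
      omega)
  refine ⟨.seq (copy (ins 0) base (base + 4)) (.seq (clear (base + 1)) (.seq p (.seq
    (.loop base (.seq q (.seq (copy (base + 3) (base + 2) (base + 4)) (.inc (base + 1)))))
    (copy (base + 2) out (base + 4))))), fun M => ?_⟩
  have h0 := hins 0
  set v : List.Vector ℕ (n + 1) := List.Vector.ofFn fun i => M (ins i) with hv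
  have hhead : v.head = M (ins 0) := by simp [hv]
  have htail : v.tail = List.Vector.ofFn fun i : Fin n => M (ins i.succ) := by
    simp [hv, List.Vector.tail_ofFn]
  obtain ⟨M₁, h₁, hval₁, hM₁⟩ := exists_runs_copy (a := ins 0) (b := base) (t := base + 4)
    (by omega) (by omega) (by omega) M
  obtain ⟨M₂, h₂, hval₂, hM₂⟩ := exists_runs_clear (base + 1) M₁
  obtain ⟨M₃, h₃, hval₃, hM₃⟩ := hp M₂
  let rec_ (y : ℕ) : ℕ := y.rec (f v.tail) fun y IH => g (y ::ᵥ IH ::ᵥ v.tail)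
  have hlow₂ : ∀ r < base, M₂ r = M r := fun r hr => by
    rw [hM₂ r (by omega), hM₁ r (by omega) (by omega)]
  have hlow₃ : ∀ r < base, M₃ r = M r := fun r hr => by
    rw [hM₃ r (by omega) (by omega), hlow₂ r hr]
  obtain ⟨M₄, h₄, hcnt₄, hy₄, hacc₄, hM₄⟩ := runs_loop (r := base)
    (p := .seq q (.seq (copy (base + 3) (base + 2) (base + 4)) (.inc (base + 1))))
    (I := fun k M' => M' base = k ∧ M' (base + 1) + k = M (ins 0) ∧
      M' (base + 2) = rec_ (M' (base + 1)) ∧ ∀ r < base, M' r = M r)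
    (fun _ _ h => h.1)
    (fun k M' ⟨hcnt, hy, hacc, hlow⟩ => by
      obtain ⟨N₁, k₁, hv₁, hN₁⟩ := hq (update M' base k)
      obtain ⟨N₂, k₂, hv₂, hN₂⟩ := exists_runs_copy (a := base + 3) (b := base + 2) (t := base + 4)
        (by omega) (by omega) (by omega) N₁
      have hN (r : ℕ) (hr : r < base + 2) : N₂ r = update M' base k r := by
        rw [hN₂ r (by omega) (by omega), hN₁ r (by omega) (by omega)]
      have hval : N₁ (base + 3) = rec_ (M' (base + 1) + 1) := by
        rw [hv₁]
        change _ = g (M' (base + 1) ::ᵥ rec_ (M' (base + 1)) ::ᵥ v.tail)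
        rw [htail, ← hacc]
        have : ∀ i : Fin n, update M' base k (ins i.succ) = M (ins i.succ) := fun i => by
          have := hins i.succ
          rw [update_of_ne (by omega), hlow _ this]
        simp [List.Vector.ofFn, this]
      refine ⟨_, .seq k₁ (.seq k₂ (.inc _ _)), ?_, ?_, ?_, fun r hr => ?_⟩
      · rw [update_of_ne (by omega), hN _ (by omega), update_self]
      · rw [update_self, hN _ (by omega), update_of_ne (by omega)]
        omega
      · rw [update_of_ne (by omega), update_self, hv₂, hval, hN _ (by omega),
          update_of_ne (by omega)]
      · rw [update_of_ne (by omega), hN _ (by omega), update_of_ne (by omega), hlow r hr])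
    (k := M (ins 0)) (M := M₃)
    ⟨by rw [hM₃ _ (by omega) (by omega), hM₂ _ (by omega), hval₁],
      by rw [hM₃ _ (by omega) (by omega), hval₂]; omega, by
        rw [hM₃ (base + 1) (by omega) (by omega), hval₂, hval₃]
        change _ = f v.tail
        rw [htail]
        simp only [fun i : Fin n => hlow₂ _ (hins i.succ)], hlow₃⟩
  obtain ⟨M₅, h₅, hval₅, hM₅⟩ := exists_runs_copy (a := base + 2) (b := out) (t := base + 4)
    (by omega) (by omega) (by omega) M₄
  refine ⟨M₅, .seq h₁ (.seq h₂ (.seq h₃ (.seq h₄ h₅))), ?_, fun r hr hr' => ?_⟩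
  · rw [hval₅, hacc₄]
    exact congrArg rec_ (hy₄.trans hhead.symm)
  · rw [hM₅ r hr' (by omega), hM₄ r hr]

theorem computes_of_primrec {n : ℕ} {f : List.Vector ℕ n → ℕ} (hf : Nat.Primrec' f) :
    Computes f := by
  induction hf with
  | zero =>
    intro ins out base _ _ _
    refine ⟨clear out, fun M => ?_⟩
    obtain ⟨M', h, h0, h'⟩ := exists_runs_clear out M
    exact ⟨M', h, h0, fun r _ hr => h' r hr⟩
  | succ =>
    intro ins out base hins hout hne
    have := hins 0
    refine ⟨.seq (copy (ins 0) out base) (.inc out), fun M => ?_⟩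
    obtain ⟨M', h, h0, h'⟩ := exists_runs_copy (hne 0) (hins 0).ne hout.ne M
    refine ⟨_, .seq h (.inc _ _), ?_, fun r hr hr' => ?_⟩
    · simp [h0]
    · rw [update_of_ne hr', h' r hr' hr.ne]
  | get i =>
    intro ins out base hins hout hne
    refine ⟨copy (ins i) out base, fun M => ?_⟩
    obtain ⟨M', h, h0, h'⟩ := exists_runs_copy (hne i) (hins i).ne hout.ne M
    exact ⟨M', h, by simp [h0], fun r hr hr' => h' r hr' hr.ne⟩
  | comp g _ _ ihf ihg => exact ihf.comp ihg
  | prec _ _ ihf ihg => exact ihf.prec ihg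

/-- A bound for the registers used in a program. -/
def bound : CounterProg ℕ → ℕ
  | .skip => 0
  | .inc r => r + 1
  | .seq p q => max p.bound q.bound
  | .loop r p => max (r + 1) p.bound

/-- Renaming of registers. -/
def map {ι κ : Type} (g : ι → κ) : CounterProg ι → CounterProg κ
  | .skip => .skip
  | .inc r => .inc (g r)
  | .seq p q => .seq (p.map g) (q.map g)
  | .loop r p => .loop (g r) (p.map g)

theorem val_ofNat_of_lt {N r : ℕ} [NeZero N] (hr : r < N) : ((Fin.ofNat N r : Fin N) : ℕ) = r :=
  Nat.mod_eq_of_lt hr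

theorem update_comp_val {N r x : ℕ} [NeZero N] (hr : r < N) (M : ℕ → ℕ) :
    (fun i : Fin N => update M r x i) = update (fun i : Fin N => M i) (Fin.ofNat N r) x := by
  funext i
  have : i = Fin.ofNat N r ↔ (i : ℕ) = r := by rw [Fin.ext_iff, val_ofNat_of_lt hr]
  simp only [update_apply, this]

/-- A program touches only registers below its bound, where reduction modulo `N` is the identity;
this passes to finitely many counters. -/
theorem Runs.map_ofNat {N : ℕ} [NeZero N] {p : CounterProg ℕ} {M M' : ℕ → ℕ} (h : Runs p M M')
    (hp : p.bound ≤ N) :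
    Runs (p.map (Fin.ofNat N)) (fun i : Fin N => M i) (fun i : Fin N => M' i) := by
  induction h with
  | skip M => exact .skip _
  | inc r M =>
    have hr : r < N := hp
    rw [update_comp_val hr]
    have := Runs.inc (Fin.ofNat N r) (fun i : Fin N => M i)
    rwa [val_ofNat_of_lt hr] at this
  | seq h₁ h₂ ih₁ ih₂ =>
    exact .seq (ih₁ ((le_max_left _ _).trans hp)) (ih₂ ((le_max_right _ _).trans hp))
  | loop_zero r p M h =>
    have hr : r < N := (le_max_left _ _).trans hp
    exact .loop_zero _ _ _ (by rwa [val_ofNat_of_lt hr])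
  | @loop_succ r p M₁ M₂ M₃ h h₁ h₂ ih₁ ih₂ =>
    have hr : r < N := (le_max_left _ _).trans hp
    refine .loop_succ (M₂ := fun i : Fin N => M₂ i) ?_ ?_ (ih₂ hp)
    · rwa [val_ofNat_of_lt hr]
    · have := ih₁ ((le_max_right _ _).trans hp)
      rw [update_comp_val hr] at this
      rwa [val_ofNat_of_lt hr]

/-- Search for a zero of a function computed by `p`: if `p` computes `h x k` in the register `c`
from `x` and `k` in the registers `a` and `b`, then `search p b c` halts iff `h x` has a zero. -/
def search {ι : Type} (p : CounterProg ι) (b c : ι) : CounterProg ι :=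
  .seq (.inc c) (.loop c (.seq p (.inc b)))

/-- The loop acts as a while loop, because its body overwrites the loop register `c` with `h x k`.
The initial increment of `c` forces the first iteration. -/
theorem search_halts_iff {ι : Type} [DecidableEq ι] {p : CounterProg ι} {a b c : ι}
    (hab : a ≠ b) (hac : a ≠ c) (hbc : b ≠ c) {h : ℕ → ℕ → ℕ}
    (hp : ∀ M, ∃ M', Runs p M M' ∧ M' c = h (M a) (M b) ∧ M' a = M a ∧ M' b = M b) (x : ℕ) :
    (∃ M', Relation.ReflTransGen Step ([search p b c], update 0 a x) ([], M')) ↔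
      ∃ k, h x k = 0 := by
  set body : CounterProg ι := .loop c (.seq p (.inc b)) with hbody
  let Good (k : ℕ) (M : ι → ℕ) : Prop := M a = x ∧ M b = k ∧ M c ≠ 0
  have hstart : ∃ M, Good 0 M ∧
      Relation.ReflTransGen Step ([search p b c], update 0 a x) ([body], M) := by
    refine ⟨_, ⟨?_, ?_, ?_⟩, .head (step_of_trans (.seq _ _ []) rfl) ((Runs.inc c _).steps [body])⟩
    · simp [hac]
    · simp [hbc, hab.symm]
    · simp
  have hnext {k : ℕ} {M : ι → ℕ} (hM : Good k M) : ∃ u, Step ([body], M) u ∧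
      ∃ M', Relation.ReflTransGen Step u ([body], M') ∧ M' a = x ∧ M' b = k + 1 ∧
        M' c = h x k := by
    obtain ⟨ha, hb, hc⟩ := hM
    -- The loop has just decremented `c`, which is harmless because the output of `p` depends only
    -- on `a` and `b`.
    obtain ⟨M', hr, hc', ha', hb'⟩ := hp (update M c (M c - 1))
    rw [update_of_ne hac, ha] at hc' ha'
    rw [update_of_ne hbc, hb] at hc' hb'
    refine ⟨_, step_of_trans (.loop_succ c _ []) ⟨hc, rfl⟩, _, (Runs.seq hr (.inc b M')).steps [body],
      ?_, ?_, ?_⟩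
    · rw [update_of_ne hab, ha']
    · rw [update_self, hb']
    · rw [update_of_ne hbc.symm, hc']
  constructor
  · rintro ⟨M', hM'⟩
    by_contra hzero
    push Not at hzero
    -- Without a zero, every reachable configuration can still return to the head of the loop with
    -- `c` nonzero. Determinism carries this along a path, and the empty stack violates it.
    have key (u) (hu : Relation.ReflTransGen Step ([search p b c], update 0 a x) u) :
        ∃ k M, Good k M ∧ Relation.ReflTransGen Step u ([body], M) := by
      induction hu with
      | refl =>
        obtain ⟨M, hM, hs⟩ := hstart
        exact ⟨0, M, hM, hs⟩
      | @tail u v _ huv ih =>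
        obtain ⟨k, M, hM, hs⟩ := ih
        rcases hs.cases_head with rfl | ⟨w, huw, hw⟩
        · obtain ⟨w, huw, M', hw, ha, hb, hc⟩ := hnext hM
          rw [huv.unique huw]
          exact ⟨k + 1, M', ⟨ha, hb, hc ▸ hzero k⟩, hw⟩
        · rw [huv.unique huw]
          exact ⟨k, M, hM, hw⟩
    obtain ⟨k, M, -, hs⟩ := key _ hM'
    rcases hs.cases_head with h' | ⟨w, hw, -⟩
    · simp at h'
    · exact not_step_nil hw
  · intro hex
    classical
    have hreach (k : ℕ) (hk : ∀ j < k, h x j ≠ 0) : ∃ M, Good k M ∧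
        Relation.ReflTransGen Step ([search p b c], update 0 a x) ([body], M) := by
      induction k with
      | zero => exact hstart
      | succ k ih =>
        obtain ⟨M, hM, hs⟩ := ih fun j hj => hk j (by omega)
        obtain ⟨u, hu, M', hs', ha, hb, hc⟩ := hnext hM
        exact ⟨M', ⟨ha, hb, hc ▸ hk k (by omega)⟩, hs.trans (.head hu hs')⟩
    obtain ⟨M, hM, hs⟩ := hreach (Nat.find hex) fun j hj => Nat.find_min hex hj
    obtain ⟨u, hu, M', hs', -, -, hc⟩ := hnext hM
    refine ⟨M', (hs.trans (.head hu hs')).tail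
      (step_of_trans (.loop_zero c _ []) ⟨hc.trans (Nat.find_spec hex), rfl⟩)⟩

end CounterProg

/-! ### A universal counter machine. -/

/-- The halting problem for pairs of a code of a partial recursive function and an argument. -/
def CodeHalts (x : ℕ) : Prop :=
  ((Denumerable.ofNat Nat.Partrec.Code x.unpair.1).eval x.unpair.2).Dom

/-- The steps of a set of transitions. -/
def TransitionStep {Q ι : Type} [DecidableEq ι] (Tr : Set (Q × CounterOp ι × Q))
    (u v : Q × (ι → ℕ)) : Prop :=
  ∃ op, (u.1, op, v.1) ∈ Tr ∧ op.Rel u.2 v.2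

/-- `k` is the bound in the step-bounded evaluation of codes, and the value `0` signals that it has
produced a result. -/
theorem exists_primrec_codeHalts :
    ∃ h : ℕ → ℕ → ℕ, Primrec₂ h ∧ ∀ x, CodeHalts x ↔ ∃ k, h x k = 0 := by
  refine ⟨fun x k => bif (Nat.Partrec.Code.evaln k
    (Denumerable.ofNat Nat.Partrec.Code x.unpair.1) x.unpair.2).isSome then 0 else 1, ?_,
    fun x => ?_⟩
  · have h₁ : Primrec fun p : ℕ × ℕ => p.1.unpair := Primrec.unpair.comp .fst
    refine Primrec.cond (Primrec.option_isSome.comp (Nat.Partrec.Code.primrec_evaln.comp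
      (Primrec.pair (Primrec.pair .snd ((Primrec.ofNat _).comp (Primrec.fst.comp h₁)))
        (Primrec.snd.comp h₁)))) (Primrec.const 0) (Primrec.const 1)
  · rw [CodeHalts, Part.dom_iff_mem]
    simp only [Nat.Partrec.Code.evaln_complete]
    rw [exists_comm]
    refine exists_congr fun k => ?_
    rw [show (∃ a, a ∈ Nat.Partrec.Code.evaln k (Denumerable.ofNat Nat.Partrec.Code x.unpair.1)
      x.unpair.2) ↔ _ from Option.isSome_iff_exists.symm]
    cases (Nat.Partrec.Code.evaln k
      (Denumerable.ofNat Nat.Partrec.Code x.unpair.1) x.unpair.2).isSome <;> simp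

/-- A counter machine which halts exactly on the positive instances of the halting problem. -/
theorem exists_universal_counterMachine :
    ∃ (N : ℕ) (i₀ : Fin N) (Q : Type) (_ : Finite Q) (Tr : Set (Q × CounterOp (Fin N) × Q))
      (start halt : Q), ∀ x, CodeHalts x ↔
        ∃ c, Relation.ReflTransGen (TransitionStep Tr) (start, update 0 i₀ x) (halt, c) := by
  obtain ⟨h, hprim, hh⟩ := exists_primrec_codeHalts
  -- Registers 0 and 1 hold the arguments `x` and `k`, and register 2 receives the value.
  obtain ⟨p, hp⟩ := CounterProg.computes_of_primrec (Nat.Primrec'.prim_iff₂.2 hprim)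
    ![0, 1] 2 3 (fun i => by fin_cases i <;> simp) (by simp) (fun i => by fin_cases i <;> simp)
  let N := max 3 p.bound
  have hN : 3 ≤ N := le_max_left _ _
  have : NeZero N := ⟨by omega⟩
  let P : CounterProg (Fin N) := p.map (Fin.ofNat N)
  have hval (r : ℕ) (hr : r < 3) : ((Fin.ofNat N r : Fin N) : ℕ) = r :=
    CounterProg.val_ofNat_of_lt (by omega)
  have hne {r r' : ℕ} (hr : r < 3) (hr' : r' < 3) (h : r ≠ r') :
      Fin.ofNat N r ≠ Fin.ofNat N r' := fun he => by
    rw [Fin.ext_iff, hval r hr, hval r' hr'] at he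
    exact h he
  have hP (M : Fin N → ℕ) : ∃ M', CounterProg.Runs P M M' ∧
      M' (Fin.ofNat N 2) = h (M (Fin.ofNat N 0)) (M (Fin.ofNat N 1)) ∧
      M' (Fin.ofNat N 0) = M (Fin.ofNat N 0) ∧ M' (Fin.ofNat N 1) = M (Fin.ofNat N 1) := by
    obtain ⟨M', hr, hout, hM'⟩ := hp fun r => M (Fin.ofNat N r)
    have := hr.map_ofNat (N := N) (le_max_right _ _)
    simp only [Fin.ofNat_val_eq_self] at this
    refine ⟨_, this, ?_, ?_, ?_⟩
    · rw [hval 2 (by omega), hout]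
      rfl
    · rw [hval 0 (by omega), hM' 0 (by omega) (by omega)]
    · rw [hval 1 (by omega), hM' 1 (by omega) (by omega)]
  let main := CounterProg.search P (Fin.ofNat N 1) (Fin.ofNat N 2)
  let Q := {K // K ∈ CounterProg.residuals main []}
  let Tr : Set (Q × CounterOp (Fin N) × Q) := {t | CounterProg.Trans t.1.1 t.2.1 t.2.2.1}
  refine ⟨N, Fin.ofNat N 0, Q, (CounterProg.finite_residuals main []).to_subtype, Tr,
    ⟨[main], CounterProg.cons_mem_residuals _ _⟩, ⟨[], CounterProg.mem_residuals _ _⟩, fun x => ?_⟩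
  rw [hh, ← CounterProg.search_halts_iff (hne (by omega) (by omega) (by omega))
    (hne (by omega) (by omega) (by omega)) (hne (by omega) (by omega) (by omega)) hP]
  refine exists_congr fun c => ⟨fun hs => ?_, fun hs => ?_⟩
  · have key (u) (hu : Relation.ReflTransGen CounterProg.Step
        ([main], update 0 (Fin.ofNat N 0) x) u) :
        ∃ hK : u.1 ∈ CounterProg.residuals main [], Relation.ReflTransGen (TransitionStep Tr)
          (⟨[main], CounterProg.cons_mem_residuals _ _⟩, update 0 (Fin.ofNat N 0) x)
          (⟨u.1, hK⟩, u.2) := by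
      induction hu with
      | refl => exact ⟨CounterProg.cons_mem_residuals _ _, .refl⟩
      | @tail u v _ huv ih =>
        obtain ⟨hK, hs⟩ := ih
        obtain ⟨op, hT, hop⟩ := huv
        have hK' : v.1 ∈ CounterProg.residuals main [] := by
          -- The second case would be a transition of the empty stack.
          rcases hT.mem_residuals hK with h' | h'
          · exact h'
          · rw [h'] at hT
            cases hT
        exact ⟨hK', hs.tail ⟨op, hT, hop⟩⟩
    exact (key _ hs).2
  · exact Relation.ReflTransGen.lift (p := CounterProg.Step)
      (fun u : Q × (Fin N → ℕ) => (u.1.1, u.2)) (fun _ _ ⟨op, hT, hop⟩ => ⟨op, hT, hop⟩) _ _ hs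

/-! ### Turing machines as instances of the halting problem for partial recursive functions. -/

section Simulation

/-- One step of a Turing machine given by a table. The lists contain the symbols to the left of the
head and the symbols from the head on, both starting next to the head. -/
def simStep (d : List (List (ℕ × ℕ × Bool))) (c : ℕ × List ℕ × List ℕ) :
    ℕ × List ℕ × List ℕ :=
  let e := (d.getD c.1 []).getD c.2.2.headI (0, 0, false)
  bif e.2.2 then (e.1, e.2.1 :: c.2.1, c.2.2.tail)
  else (e.1, c.2.1.tail, c.2.1.headI :: e.2.1 :: c.2.2.tail)

/-- The data from which the Gödel number of a machine is computed. -/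
abbrev MachineData : Type := ℕ × ℕ × ℕ × ℕ × List (List (ℕ × ℕ × Bool))

/-- The machine with a given Gödel number is in its halting state after `t` steps. -/
def HaltsAt (n t : ℕ) : Prop :=
  let d : MachineData := (Encodable.decode n).getD (0, 0, 0, 0, [])
  ((simStep d.2.2.2.2)^[t] (d.2.2.1, [], [])).1 = d.2.2.2.1

theorem primrec_simStep : Primrec₂ simStep := by
  have hc : Primrec fun p : List (List (ℕ × ℕ × Bool)) × (ℕ × List ℕ × List ℕ) => p.2 := .snd
  have hL := Primrec.fst.comp (Primrec.snd.comp hc)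
  have hR := Primrec.snd.comp (Primrec.snd.comp hc)
  have he : Primrec fun p : List (List (ℕ × ℕ × Bool)) × (ℕ × List ℕ × List ℕ) =>
      (p.1.getD p.2.1 []).getD p.2.2.2.headI (0, 0, false) :=
    (Primrec.list_getD _).comp ((Primrec.list_getD _).comp .fst (Primrec.fst.comp hc))
      (Primrec.list_headI.comp hR)
  have h₁ := Primrec.fst.comp he
  have h₂ := Primrec.fst.comp (Primrec.snd.comp he)
  exact Primrec.cond (Primrec.snd.comp (Primrec.snd.comp he))
    (h₁.pair ((Primrec.list_cons.comp h₂ hL).pair (Primrec.list_tail.comp hR)))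
    (h₁.pair ((Primrec.list_tail.comp hL).pair (Primrec.list_cons.comp (Primrec.list_headI.comp hL)
      (Primrec.list_cons.comp h₂ (Primrec.list_tail.comp hR)))))

theorem primrec_haltsAt : PrimrecRel HaltsAt := by
  have hd : Primrec fun p : ℕ × ℕ =>
      ((Encodable.decode p.1 : Option MachineData).getD (0, 0, 0, 0, [])) :=
    Primrec.option_getD.comp (Primrec.decode.comp .fst) (Primrec.const _)
  have h2 := Primrec.snd.comp (Primrec.snd.comp hd)
  refine Primrec.eq.comp (Primrec.fst.comp (Primrec.nat_iterate (β := ℕ × List ℕ × List ℕ) .snd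
    ((Primrec.fst.comp h2).pair (Primrec.const ([], []))) ?_))
    (Primrec.fst.comp (Primrec.snd.comp h2))
  exact primrec_simStep.comp ((Primrec.snd.comp (Primrec.snd.comp h2)).comp .fst) .snd

namespace DTM

variable (M : DTM)

/-- The table of the transition function. -/
def table : List (List (ℕ × ℕ × Bool)) :=
  List.ofFn fun q => List.ofFn fun a =>
    (((M.δ q a).1 : ℕ), ((M.δ q a).2.1 : ℕ), dirBit (M.δ q a).2.2)

/-- The lists `L` and `R` describe a tape. -/
def Represents (c : M.Config) (d : ℕ × List ℕ × List ℕ) : Prop :=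
  ∃ L R : List (Fin (M.numSymbols + 1)), d = ((c.1 : ℕ), L.map Fin.val, R.map Fin.val) ∧
    c.2 = Turing.Tape.mk' (Turing.ListBlank.mk L) (Turing.ListBlank.mk R)

/-- True for the empty list as well, since both defaults are `0`, the blank. -/
theorem headI_map_val {s : ℕ} (l : List (Fin (s + 1))) : (l.map Fin.val).headI = l.headI := by
  cases l <;> rfl

theorem getD_ofFn {α : Type} {n : ℕ} (f : Fin n → α) (i : Fin n) (d : α) :
    (List.ofFn f).getD i d = f i := by
  simp [List.getD]

/-- The lists may omit blanks at their far ends, because reading beyond them yields the blank. The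
defaults of the table lookup are never used: state and symbol are always in range. -/
theorem represents_step {c : M.Config} {d : ℕ × List ℕ × List ℕ} (h : M.Represents c d) :
    M.Represents (M.step c) (simStep M.table d) := by
  obtain ⟨q, t⟩ := c
  obtain ⟨L, R, rfl, rfl : t = _⟩ := h
  have hentry : (M.table.getD q []).getD (R.map Fin.val).headI (0, 0, false) =
      (((M.δ q R.headI).1 : ℕ), ((M.δ q R.headI).2.1 : ℕ), dirBit (M.δ q R.headI).2.2) := by
    rw [headI_map_val, table, getD_ofFn, getD_ofFn]
  have hhead : (Turing.Tape.mk' (Turing.ListBlank.mk L) (Turing.ListBlank.mk R)).head =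
      R.headI := rfl
  simp only [step, simStep, hentry, hhead]
  rcases M.δ q R.headI with ⟨q', a, dir⟩
  cases dir with
  | left =>
    refine ⟨L.tail, L.headI :: a :: R.tail, ?_, ?_⟩
    · simp [dirBit, headI_map_val, List.map_tail]
    · simp [Turing.Tape.mk', Turing.Tape.write, Turing.Tape.move, Turing.ListBlank.head_mk,
        Turing.ListBlank.tail_mk, Turing.ListBlank.cons_mk]
  | right =>
    refine ⟨a :: L, R.tail, ?_, ?_⟩
    · simp [dirBit, List.map_tail]
    · simp [Turing.Tape.mk', Turing.Tape.write, Turing.Tape.move, Turing.ListBlank.head_mk,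
        Turing.ListBlank.tail_mk, Turing.ListBlank.cons_mk]

theorem exists_haltsAt_iff : (∃ t, HaltsAt M.code t) ↔ M.HaltsOnEmptyTape := by
  refine exists_congr fun t => ?_
  have hrep : M.Represents (M.step^[t] (M.start, Turing.Tape.mk₁ []))
      ((simStep M.table)^[t] (M.start, [], [])) := by
    induction t with
    | zero => exact ⟨[], [], rfl, rfl⟩
    | succ t ih =>
      rw [iterate_succ_apply', iterate_succ_apply']
      exact M.represents_step ih
  obtain ⟨L, R, h, -⟩ := hrep
  simp only [HaltsAt, code, Encodable.encodek, Option.getD_some]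
  change ((simStep M.table)^[t] ((M.start : ℕ), [], [])).1 = (M.halt : ℕ) ↔ _
  rw [h, Fin.ext_iff]

end DTM

/-- Existential quantification over a primitive recursive relation reduces to the halting
problem. -/
theorem exists_primrec_codeHalts_iff {R : ℕ → ℕ → Prop} (hR : PrimrecRel R) :
    ∃ g : ℕ → ℕ, Primrec g ∧ ∀ n, CodeHalts (g n) ↔ ∃ t, R n t := by
  classical
  have hpart : Partrec fun n : ℕ => Nat.rfind fun t => Part.some (decide (R n t)) :=
    Partrec.rfind (p := fun n t => Part.some (decide (R n t))) hR.decide.to_comp.partrec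
  obtain ⟨c, hc⟩ := Nat.Partrec.Code.exists_code.1 (Partrec.nat_iff.1 hpart)
  refine ⟨fun n => Nat.pair (Encodable.encode c) n,
    Primrec₂.natPair.comp (Primrec.const _) .id, fun n => ?_⟩
  rw [CodeHalts, Nat.unpair_pair, Denumerable.ofNat_encode, hc]
  exact Nat.rfind_dom.trans (by simp)

end Simulation

/-! ### The product with the star, and sentences about its computations. -/

section Product

variable {Q ι : Type} [DecidableEq ι] {k : ℕ}

/-- The labels of the product synchronized on all labels. -/
abbrev ProductLabel (k : ℕ) : Type :=
  (Empty ⊕ Empty) ⊕ {c // c ∈ diagConstraint (Fin k ⊕ Fin k)}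

/-- The label of the product for the label `a` of the components. -/
def productLabel (a : Fin k ⊕ Fin k) : ProductLabel k :=
  .inr ⟨(some a, some a), Finset.mem_image_of_mem _ (Finset.mem_univ a)⟩

theorem productLabel_surjective : Surjective (productLabel (k := k)) := by
  rintro ((e | e) | ⟨c, hc⟩)
  · exact e.elim
  · exact e.elim
  · obtain ⟨a, -, rfl⟩ := Finset.mem_image.1 hc
    exact ⟨a, rfl⟩

/-- The product with the star graph synchronized on all labels. -/
abbrev starProduct {V : Type} (G : LGraph (Fin k ⊕ Fin k) V) :
    LGraph (ProductLabel k) (V × Option (Fin k)) :=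
  G.allSync.syncProduct (starGraph (Fin k)).allSync (diagConstraint (Fin k ⊕ Fin k))

theorem starProduct_edge {V : Type} (G : LGraph (Fin k ⊕ Fin k) V) (a : Fin k ⊕ Fin k)
    (u v : V × Option (Fin k)) : (starProduct G).edge (productLabel a) u v ↔
      G.edge a u.1 v.1 ∧ (starGraph (Fin k)).edge a u.2 v.2 :=
  Iff.rfl

variable (T : Fin k → Q × CounterOp ι × Q)

/-- The steps of the product that start at the center of the star are transitions. -/
theorem starProduct_transition_iff (j : Fin k) (v z : (Q × (ι → ℕ)) × Option (Fin k)) :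
    (∃ w, (starProduct (counterGraph T)).edge (productLabel (.inl j)) v w ∧
      (starProduct (counterGraph T)).edge (productLabel (.inr j)) w z) ↔
    v.2 = none ∧ z.2 = none ∧ v.1.1 = (T j).1 ∧ z.1.1 = (T j).2.2 ∧
      (T j).2.1.Rel v.1.2 z.1.2 := by
  simp only [starProduct_edge]
  constructor
  · rintro ⟨⟨⟨q, c⟩, o⟩, ⟨⟨h₁, h₂, h₃⟩, h₄, h₅⟩, ⟨h₆, h₇⟩, h₈, h₉⟩
    dsimp only at h₂ h₃ h₆ h₇
    exact ⟨h₄, h₉, h₁, h₆.trans h₂, h₃ ▸ h₇⟩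
  · rintro ⟨h₁, h₂, h₃, h₄, h₅⟩
    -- Halfway through a transition the state has changed and the counters have not.
    exact ⟨((z.1.1, v.1.2), some j), ⟨⟨h₃, h₄, rfl⟩, h₁, rfl⟩, ⟨rfl, h₅⟩, rfl, h₂⟩

/-- The invariant also covers the leaves: over the leaf of `j` the transition `j` is half done, so
the state is already the target, while the source state with the present counters has been reached
by full transitions. From there only the operation of `j` is possible. -/
theorem starProduct_reach_iff (u w : Q × (ι → ℕ)) :
    (starProduct (counterGraph T)).Reach Finset.univ (u, none) (w, none) ↔
      Relation.ReflTransGen (TransitionStep (Set.range T)) u w := by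
  constructor
  · intro h
    have key (x) (hx : (starProduct (counterGraph T)).Reach Finset.univ (u, none) x) :
        match x.2 with
        | none => Relation.ReflTransGen (TransitionStep (Set.range T)) u x.1
        | some j => x.1.1 = (T j).2.2 ∧
            Relation.ReflTransGen (TransitionStep (Set.range T)) u ((T j).1, x.1.2) := by
      induction hx with
      | refl => exact .refl
      | @tail x y _ hxy ih =>
        obtain ⟨a, -, h⟩ := hxy
        obtain ⟨a, rfl⟩ := productLabel_surjective a
        obtain ⟨⟨q, c⟩, o⟩ := x
        obtain ⟨⟨q', c'⟩, o'⟩ := y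
        rw [starProduct_edge] at h
        cases a with
        | inl j =>
          obtain ⟨⟨h₁, h₂, h₃⟩, h₄, h₅⟩ := h
          dsimp only at h₁ h₂ h₃ h₄ h₅
          subst h₁ h₃ h₄ h₅
          exact ⟨h₂, ih⟩
        | inr j =>
          obtain ⟨⟨h₁, h₂⟩, h₃, h₄⟩ := h
          dsimp only at h₁ h₂ h₃ h₄
          subst h₁ h₃ h₄
          obtain ⟨rfl, ih⟩ := ih
          exact ih.tail ⟨(T j).2.1, ⟨j, rfl⟩, h₂⟩
    exact key _ h
  · intro h
    induction h with
    | refl => exact .refl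
    | @tail v w _ h ih =>
      obtain ⟨op, ⟨j, hj⟩, hop⟩ := h
      obtain ⟨x, hx, hx'⟩ := (starProduct_transition_iff T j (v, none) (w, none)).2
        ⟨rfl, rfl, by rw [hj], by rw [hj], by rw [hj]; exact hop⟩
      exact (ih.tail ⟨_, Finset.mem_univ _, hx⟩).tail ⟨_, Finset.mem_univ _, hx'⟩

/-- After some transition `j` from the vertex `0`, the vertex reached satisfies `φ`. -/
def afterTransition (j : Fin k) (φ : FORFormula (ProductLabel k)) :
    FORFormula (ProductLabel k) :=
  .ex 1 (.and (.edge (productLabel (.inl j)) 0 1)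
    (.ex 0 (.and (.edge (productLabel (.inr j)) 1 0) φ)))

/-- From the vertex `0`, some vertex with an outgoing edge for `j` is reachable. -/
def reachesTransition (j : Fin k) : FORFormula (ProductLabel k) :=
  .ex 1 (.and (.reach Finset.univ 0 1) (.ex 0 (.edge (productLabel (.inl j)) 1 0)))

/-- The formula `φ` expresses the property `p` of the vertex `0`. -/
def Expresses {L V : Type} (G : LGraph L V) (φ : FORFormula L) (p : V → Prop) : Prop :=
  ∀ s : ℕ → V, G.Sat φ s ↔ p (s 0)

variable {T}

/-- The two variables 0 and 1 are reused, the inner quantifier rebinding 0 to the new vertex. Hence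
the construction can be iterated any number of times. -/
theorem expresses_afterTransition {φ : FORFormula (ProductLabel k)}
    {p : (Q × (ι → ℕ)) × Option (Fin k) → Prop}
    (h : Expresses (starProduct (counterGraph T)) φ p) (j : Fin k) :
    Expresses (starProduct (counterGraph T)) (afterTransition j φ) fun v =>
      v.2 = none ∧ v.1.1 = (T j).1 ∧ ∃ c, (T j).2.1.Rel v.1.2 c ∧ p (((T j).2.2, c), none) := by
  intro s
  have : (starProduct (counterGraph T)).Sat (afterTransition j φ) s ↔
      ∃ z, (∃ w, (starProduct (counterGraph T)).edge (productLabel (.inl j)) (s 0) w ∧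
        (starProduct (counterGraph T)).edge (productLabel (.inr j)) w z) ∧ p z := by
    constructor
    · rintro ⟨w, hw, z, hz, hφ⟩
      exact ⟨z, ⟨w, by simpa using! hw, by simpa using! hz⟩, by simpa using (h _).1 hφ⟩
    · rintro ⟨z, ⟨w, hw, hz⟩, hp⟩
      exact ⟨w, by simpa [LGraph.Sat] using! hw, z, by simpa [LGraph.Sat] using! hz,
        (h _).2 (by simpa using hp)⟩
  rw [this]
  simp only [starProduct_transition_iff]
  constructor
  · rintro ⟨⟨⟨q, c⟩, o⟩, ⟨h₁, h₂, h₃, h₄, h₅⟩, hp⟩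
    dsimp only at h₂ h₄ h₅
    subst h₂ h₄
    exact ⟨h₁, h₃, c, h₅, hp⟩
  · rintro ⟨h₁, h₃, c, h₅, hp⟩
    exact ⟨_, ⟨h₁, rfl, h₃, rfl, h₅⟩, hp⟩

/-- An outgoing edge for `j` exists exactly at the vertices over the center whose state is the
source of `j`; the counters and the operation of `j` play no role. -/
theorem sat_reachesTransition_iff {j : Fin k} {s : ℕ → (Q × (ι → ℕ)) × Option (Fin k)} :
    (starProduct (counterGraph T)).Sat (reachesTransition j) s ↔
      ∃ c, (starProduct (counterGraph T)).Reach Finset.univ (s 0) (((T j).1, c), none) := by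
  constructor
  · rintro ⟨⟨⟨q, c⟩, o⟩, hw, z, hz⟩
    replace hw : (starProduct (counterGraph T)).Reach Finset.univ (s 0) ((q, c), o) := by
      simpa [LGraph.Sat] using! hw
    replace hz : (starProduct (counterGraph T)).edge (productLabel (.inl j)) ((q, c), o) z := by
      simpa [LGraph.Sat] using! hz
    rw [starProduct_edge] at hz
    obtain ⟨⟨rfl, -⟩, rfl, -⟩ := hz
    exact ⟨c, hw⟩
  · rintro ⟨c, hc⟩
    refine ⟨(((T j).1, c), none), by simpa [LGraph.Sat] using! hc,
      (((T j).2.2, c), some j), ?_⟩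
    simp only [LGraph.Sat, update_self, ne_eq, one_ne_zero, not_false_eq_true, update_of_ne]
    exact ⟨⟨rfl, rfl, rfl⟩, rfl, rfl⟩

theorem freeVars_afterTransition (j : Fin k) {φ : FORFormula (ProductLabel k)}
    (h : φ.freeVars ⊆ {0}) : (afterTransition j φ).freeVars ⊆ {0} := by
  intro x hx
  simp only [afterTransition, FORFormula.freeVars, Finset.mem_erase, Finset.mem_union,
    Finset.mem_insert, Finset.mem_singleton] at hx ⊢
  have h' (hx : x ∈ φ.freeVars) : x = 0 := Finset.mem_singleton.1 (h hx)
  tauto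

theorem freeVars_reachesTransition (j : Fin k) :
    (reachesTransition j).freeVars ⊆ {0} := by
  intro x hx
  simp only [reachesTransition, FORFormula.freeVars, Finset.mem_erase, Finset.mem_union,
    Finset.mem_insert, Finset.mem_singleton] at hx ⊢
  tauto

theorem primrec_code_afterTransition (j : Fin k) :
    ∃ F : ℕ → ℕ, Primrec F ∧
      ∀ φ : FORFormula (ProductLabel k), (afterTransition j φ).code = F φ.code := by
  have hpair {f : ℕ → ℕ} (hf : Primrec f) (n : ℕ) : Primrec fun m => Nat.pair n (f m) :=
    Primrec₂.natPair.comp (Primrec.const n) hf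
  -- The new code is a nest of pairings with constants around the old one; the constants are read
  -- off by unfolding.
  exact ⟨_, hpair (hpair (hpair (hpair (hpair (hpair (hpair (hpair .id _) _) _) _) _) _) _) _,
    fun φ => rfl⟩

/-- The sentence expressing that the transition `jh` can be reached from the initial configuration
with the value `n` of one counter. The initial configuration is verified by the transitions `z`, the
value is loaded by `n` transitions `ji`, and then the computation is entered by `js`. -/
def acceptSentence (z : List (Fin k)) (ji js jh : Fin k) (n : ℕ) :
    FORFormula (ProductLabel k) :=
  .ex 0 (z.foldr afterTransition
    ((afterTransition ji)^[n] (afterTransition js (reachesTransition jh))))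

theorem freeVars_foldr_afterTransition (z : List (Fin k)) {φ : FORFormula (ProductLabel k)}
    (h : φ.freeVars ⊆ {0}) : (z.foldr afterTransition φ).freeVars ⊆ {0} := by
  induction z with
  | nil => exact h
  | cons j z ih => exact freeVars_afterTransition j ih

theorem isSentence_acceptSentence (z : List (Fin k)) (ji js jh : Fin k) (n : ℕ) :
    (acceptSentence z ji js jh n).IsSentence := by
  have hn : ((afterTransition ji)^[n] (afterTransition js (reachesTransition jh))).freeVars ⊆
      {0} := by
    induction n with
    | zero => exact freeVars_afterTransition _ (freeVars_reachesTransition _)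
    | succ n ih =>
      rw [iterate_succ_apply']
      exact freeVars_afterTransition _ ih
  have := freeVars_foldr_afterTransition z hn
  rw [FORFormula.IsSentence, acceptSentence, FORFormula.freeVars, ← Finset.subset_empty,
    ← Finset.subset_insert_iff]
  exact this

theorem primrec_code_acceptSentence (z : List (Fin k)) (ji js jh : Fin k) :
    Primrec fun n => (acceptSentence z ji js jh n).code := by
  suffices h : Primrec fun n => (z.foldr afterTransition
      ((afterTransition ji)^[n] (afterTransition js (reachesTransition jh)))).code by
    simp only [acceptSentence, FORFormula.code]
    exact Primrec₂.natPair.comp (Primrec.const 5) (Primrec₂.natPair.comp (Primrec.const 0) h)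
  induction z with
  | nil =>
    obtain ⟨F, hF, hFcode⟩ := primrec_code_afterTransition ji
    refine (Primrec.nat_iterate (h := fun _ m => F m) .id
      (Primrec.const (afterTransition js (reachesTransition jh)).code)
      (hF.comp .snd)).of_eq fun n => ?_
    induction n with
    | zero => simp only [id, iterate_zero, List.foldr_nil]
    | succ n ih =>
      simp only [id, List.foldr_nil] at ih ⊢
      rw [iterate_succ_apply', iterate_succ_apply', hFcode, ih]
  | cons j z ih =>
    obtain ⟨F, hF, hFcode⟩ := primrec_code_afterTransition j
    exact (hF.comp ih).of_eq fun n => (hFcode _).symm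

end Product

/-! ### Loading the input and recognizing acceptance. -/

section Interface

variable {Q ι : Type}

/-- The transitions of a machine together with an initial phase in the state `none`, in which
counters can be tested and incremented, and with a transition marking the halting state. The
transitions `jump`, which never complete, make all states reachable. -/
inductive LoadTransition (Tr : Set (Q × CounterOp ι × Q)) (start halt : Q) :
    Option Q × CounterOp ι × Option Q → Prop
  | zero (i : ι) : LoadTransition Tr start halt (none, .zero i, none)
  | inc (i : ι) : LoadTransition Tr start halt (none, .inc i, none)
  | jump (q : Option Q) : LoadTransition Tr start halt (none, .stuck, q)
  | enter : LoadTransition Tr start halt (none, .nop, some start)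
  | halt : LoadTransition Tr start halt (some halt, .stuck, some halt)
  | lift {q q' : Q} {op : CounterOp ι} (h : (q, op, q') ∈ Tr) :
      LoadTransition Tr start halt (some q, op, some q')

instance [Finite ι] : Finite (CounterOp ι) := by
  let f : CounterOp ι → Fin 2 ⊕ ι ⊕ ι ⊕ ι
    | .nop => .inl 0
    | .inc i => .inr (.inl i)
    | .dec i => .inr (.inr (.inl i))
    | .zero i => .inr (.inr (.inr i))
    | .stuck => .inl 1
  refine Finite.of_injective f fun a b h => ?_
  cases a <;> cases b <;> simp_all [f]

theorem exists_enumeration_loadTransition [Finite Q] [Finite ι] (Tr : Set (Q × CounterOp ι × Q))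
    (start halt : Q) : ∃ (k : ℕ) (T : Fin k → Option Q × CounterOp ι × Option Q),
      Set.range T = {t | LoadTransition Tr start halt t} := by
  let e := Finite.equivFin {t // LoadTransition Tr start halt t}
  refine ⟨_, fun j => (e.symm j).1, ?_⟩
  ext t
  constructor
  · rintro ⟨j, rfl⟩
    exact (e.symm j).2
  · exact fun h => ⟨e ⟨t, h⟩, by simp⟩

variable [DecidableEq ι]

/-- No transition leads from the machine states back to the loading state, and the marker of the
halting state never completes, so the additional transitions do not affect the machine. -/
theorem reflTransGen_loadTransition_iff {Tr : Set (Q × CounterOp ι × Q)} {start halt : Q}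
    {u v : Q × (ι → ℕ)} :
    Relation.ReflTransGen (TransitionStep {t | LoadTransition Tr start halt t})
      (some u.1, u.2) (some v.1, v.2) ↔ Relation.ReflTransGen (TransitionStep Tr) u v := by
  constructor
  · intro h
    have key (x) (hx : Relation.ReflTransGen
        (TransitionStep {t | LoadTransition Tr start halt t}) (some u.1, u.2) x) :
        ∃ q, x.1 = some q ∧ Relation.ReflTransGen (TransitionStep Tr) u (q, x.2) := by
      induction hx with
      | refl => exact ⟨_, rfl, .refl⟩
      | @tail x y _ hxy ih =>
        obtain ⟨q, hq, ih⟩ := ih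
        obtain ⟨op, hop, hrel⟩ := hxy
        obtain ⟨q₁, c₁⟩ := x
        obtain ⟨q₂, c₂⟩ := y
        dsimp only at hq hop hrel ih ⊢
        subst hq
        cases hop with
        | halt => exact hrel.elim
        | lift h => exact ⟨_, rfl, ih.tail ⟨op, h, hrel⟩⟩
    obtain ⟨q, hq, hs⟩ := key _ h
    cases hq
    exact hs
  · exact fun h => Relation.ReflTransGen.lift
      (p := TransitionStep {t | LoadTransition Tr start halt t})
      (fun u : Q × (ι → ℕ) => (some u.1, u.2))
      (fun _ _ ⟨op, h, hop⟩ => ⟨op, .lift h, hop⟩) _ _ h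

variable {k : ℕ} {T : Fin k → Option Q × CounterOp ι × Option Q}

/-- The sentence cannot name the initial vertex, but passing all zero tests in the loading state
over the center determines it uniquely. Each nested increment then adds 1 to the counter `i₀`. -/
theorem models_acceptSentence_iff {Tr : Set (Q × CounterOp ι × Q)} {start halt : Q}
    (hT : Set.range T = {t | LoadTransition Tr start halt t}) {z : List (Fin k)} {ji js jh : Fin k}
    {i₀ : ι} (hz : ∀ j ∈ z, ∃ i, T j = (none, .zero i, none))
    (hz' : ∀ i, ∃ j ∈ z, T j = (none, .zero i, none)) (hji : T ji = (none, .inc i₀, none))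
    (hjs : T js = (none, .nop, some start)) (hjh : T jh = (some halt, .stuck, some halt)) (n : ℕ) :
    (starProduct (counterGraph T)).Models (acceptSentence z ji js jh n) ↔
      ∃ c, Relation.ReflTransGen (TransitionStep Tr) (start, update 0 i₀ n) (halt, c) := by
  let Acc (c : ι → ℕ) : Prop :=
    ∃ c', Relation.ReflTransGen (TransitionStep Tr) (start, c) (halt, c')
  have hfinal : Expresses (starProduct (counterGraph T))
      (afterTransition js (reachesTransition jh)) fun v =>
        v.2 = none ∧ v.1.1 = none ∧ Acc v.1.2 := by
    intro s
    rw [expresses_afterTransition (p := fun v => ∃ c, (starProduct (counterGraph T)).Reach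
      Finset.univ v (((T jh).1, c), none)) (fun s => sat_reachesTransition_iff)]
    simp only [hjs, hjh, CounterOp.Rel, exists_eq_left]
    refine and_congr_right fun _ => and_congr_right fun _ => exists_congr fun c => ?_
    rw [starProduct_reach_iff, hT]
    exact reflTransGen_loadTransition_iff (u := (start, _)) (v := (halt, c))
  have hload (n : ℕ) : Expresses (starProduct (counterGraph T))
      ((afterTransition ji)^[n] (afterTransition js (reachesTransition jh))) fun v =>
        v.2 = none ∧ v.1.1 = none ∧ Acc (update v.1.2 i₀ (v.1.2 i₀ + n)) := by
    induction n with
    | zero => simpa using hfinal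
    | succ n ih =>
      intro s
      rw [iterate_succ_apply', expresses_afterTransition ih]
      simp only [hji, CounterOp.Rel, exists_eq_left, true_and, update_idem, update_self]
      rw [add_assoc, add_comm 1 n]
  -- Stated for any list of zero tests, to allow induction; that the actual list covers every
  -- counter is used only afterwards.
  have hzero (z : List (Fin k)) (hz : ∀ j ∈ z, ∃ i, T j = (none, .zero i, none)) :
      Expresses (starProduct (counterGraph T)) (z.foldr afterTransition
        ((afterTransition ji)^[n] (afterTransition js (reachesTransition jh)))) fun v =>
          (v.2 = none ∧ v.1.1 = none ∧ Acc (update v.1.2 i₀ (v.1.2 i₀ + n))) ∧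
            ∀ j ∈ z, ∀ i, T j = (none, .zero i, none) → v.1.2 i = 0 := by
    induction z with
    | nil => simpa using hload n
    | cons j z ih =>
      intro s
      rw [List.foldr_cons, expresses_afterTransition (ih fun j hj => hz j (by simp [hj]))]
      obtain ⟨i, hi⟩ := hz j (by simp)
      simp only [hi, CounterOp.Rel, and_assoc, exists_and_left, exists_eq_left, true_and,
        List.mem_cons, forall_eq_or_imp, Prod.mk.injEq, CounterOp.zero.injEq, and_true,
        forall_eq']
      tauto
  rw [LGraph.models_iff_sat _ (isSentence_acceptSentence z ji js jh n)
    (fun _ => ((none, 0), none))]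
  constructor
  · rintro ⟨v, hv⟩
    obtain ⟨⟨-, -, h⟩, h0⟩ := (hzero z hz _).1 hv
    rw [update_self] at h h0
    have hc : v.1.2 = 0 := funext fun i => by
      obtain ⟨j, hj, hji⟩ := hz' i
      exact h0 j hj i hji
    rw [hc] at h
    simpa using h
  · intro h
    refine ⟨((none, 0), none), (hzero z hz _).2 ?_⟩
    rw [update_self]
    exact ⟨⟨rfl, rfl, by simpa using h⟩, fun _ _ _ _ => rfl⟩

end Interface

/-! ### Undecidability, and the theorem. -/

theorem not_computablePred_codeHalts : ¬ ComputablePred CodeHalts := by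
  intro h
  refine ComputablePred.halting_problem 0 ?_
  refine ComputablePred.computable_of_manyOneReducible
    (q := CodeHalts) ⟨fun c => Nat.pair (Encodable.encode c) 0, ?_, fun c => ?_⟩ h
  · exact (Primrec₂.natPair.comp Primrec.encode (Primrec.const 0)).to_comp
  · simp [CodeHalts]

theorem theorem3p3 :
    ∃ (A : Type) (_ : Finite A) (ar : A → ℕ) (k : ℕ) (R : GTRS ar (Fin k ⊕ Fin k)),
      let C : Finset (Option (Fin k ⊕ Fin k) × Option (Fin k ⊕ Fin k)) :=
        diagConstraint (Fin k ⊕ Fin k)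
      let P := R.graph.allSync.syncProduct (starGraph (Fin k)).allSync C
      R.graph.FiniteOutDegree ∧
      R.graph.HasDecidableFOR ∧
      (starGraph (Fin k)).HasDecidableFOR ∧
      LGraph.IsSemifinite R.graph.allSync (starGraph (Fin k)).allSync C ∧
      (∃ f : ℕ → ℕ, Computable f ∧
        ∀ M : DTM, ∃ φ, φ.IsSentence ∧ φ.code = f M.code ∧
          (M.HaltsOnEmptyTape ↔ P.Models φ)) ∧
      ¬ P.HasDecidableFOR := by
  obtain ⟨N, i₀, Q, _, Tr, start, halt, huniv⟩ := exists_universal_counterMachine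
  obtain ⟨k, T, hT⟩ := exists_enumeration_loadTransition Tr start halt
  have hmem {t} (h : LoadTransition Tr start halt t) : ∃ j, T j = t := by
    have : t ∈ Set.range T := by rw [hT]; exact h
    exact this
  choose z hz using fun i => hmem (.zero i)
  obtain ⟨ji, hji⟩ := hmem (.inc i₀)
  obtain ⟨js, hjs⟩ := hmem .enter
  obtain ⟨jh, hjh⟩ := hmem .halt
  have hstate (q : Option Q) : ∃ j, (T j).1 = none ∧ (T j).2.2 = q := by
    obtain ⟨j, hj⟩ := hmem (.jump q)
    exact ⟨j, by rw [hj], by rw [hj]⟩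
  have hinc (i : Fin N) : ∃ j, (T j).2.1 = .inc i := by
    obtain ⟨j, hj⟩ := hmem (.inc i)
    exact ⟨j, by rw [hj]⟩
  let R := CounterTree.system T none
  have hedge := CounterTree.edge_iff_vertexEquiv hstate hinc
  let φ := acceptSentence (List.ofFn z) ji js jh
  have hφ (n : ℕ) : CodeHalts n ↔ (starProduct R.graph).Models (φ n) := by
    -- The isomorphism between the tree graph and the counter graph extends to the products by the
    -- identity on the star.
    rw [LGraph.models_equiv (starProduct R.graph) (starProduct (counterGraph T))
      ((CounterTree.vertexEquiv hstate hinc).prodCongr (Equiv.refl _)), huniv]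
    · refine (models_acceptSentence_iff hT (fun j hj => ?_) (fun i => ?_) hji hjs hjh n).symm
      · obtain ⟨i, rfl⟩ := List.mem_ofFn.1 hj
        exact ⟨i, hz i⟩
      · exact ⟨z i, List.mem_ofFn.2 ⟨i, rfl⟩, hz i⟩
    · intro a u v
      obtain ⟨a, rfl⟩ := productLabel_surjective a
      exact and_congr_left fun _ => hedge a u.1 v.1
  have hcode : Primrec fun n => (φ n).code := primrec_code_acceptSentence _ ji js jh
  refine ⟨TreeSymbol (Option Q) N, inferInstance, TreeSymbol.arity, k, R, ?_, ?_, ?_, ?_, ?_, ?_⟩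
  · exact LGraph.finiteOutDegree_equiv _ hedge (counterGraph_finiteOutDegree T)
  · exact LGraph.hasDecidableFOR_equiv _ _ _ hedge (counterGraph_hasDecidableFOR T)
  · exact LGraph.hasDecidableFOR_of_finite _
  -- The star is finite, so the second component has finitely many edges at all.
  · exact .inr (Set.toFinite _)
  -- The reduction passes from the code of a Turing machine to an instance of `CodeHalts`, and from
  -- there to the sentence with that number as input.
  · obtain ⟨g, hg, hgR⟩ := exists_primrec_codeHalts_iff primrec_haltsAt
    exact ⟨_, (hcode.comp hg).to_comp, fun M => ⟨φ (g M.code), isSentence_acceptSentence _ _ _ _ _,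
      rfl, by rw [← M.exists_haltsAt_iff, ← hgR, hφ]⟩⟩
  · intro h
    refine not_computablePred_codeHalts (ComputablePred.computable_of_manyOneReducible
      ⟨fun n => (φ n).code, hcode.to_comp, fun n => ?_⟩ h)
    exact (hφ n).trans (LGraph.code_mem_theoryFOR _ (isSentence_acceptSentence _ _ _ _ _)).symm
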